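/- Let $T:[0,1]\to[0,1]$ be a $C^0$ piecewise monotone transformation: there are points $0=c_0<c_1<\dots<c_N=1$ such that $T$ is continuous and strictly monotone on each open interval $\omega_l=(c_{l-1},c_l)$; the partition $\Omega=\{\omega_1,\dots,\omega_N\}$ is taken maximal (no cut point can be omitted). Let $\varphi:[0,1]\to\mathbb C$ be bounded and continuous on each $\omega\in\Omega$, with a continuous extension to $\overline\omega$, and let $$\mathcal L_\varphi h=\sum_{\omega\in\Omega}(\varphi\cdot h)\circ (T|_\omega)^{-1}\cdot \mathbf 1_{T\omega}\qquad (h:[0,1]\to\mathbb C).$$ Let $C^\infty(\mathcal I)$ be the set of $h:[0,1]\to\mathbb C$ such that, for each $\omega\in\Omega$, $h|_\omega$ extends to a $C^\infty$ function on $\overline\omega$, and let $\mathfrak A_0$ be the linear span of $\bigcup_{n\ge 0}\mathcal L_\varphi^n(C^\infty(\mathcal I))$. (As usual, functions that agree almost everywhere may be identified.) Let $(\mathfrak B,\|\cdot\|)$ be any complex Banach space such that 1. $C^\infty(\mathcal I)\subseteq\mathfrak B$; 2. $\mathcal L_\varphi$ extends to a continuous linear operator on $\mathfrak B$ (so that also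 $\mathfrak A_0\subseteq\mathfrak B$, and the operator on $\mathfrak B$ restricts to $\mathcal L_\varphi$ on $\mathfrak A_0$); 3. $\|h\|_{L^\infty}\le\|h\|$ for all $h\in\mathfrak A_0$. Let $a\in\partial\omega$ with $\omega\in\Omega$. Write $T^ka$ and $\varphi(T^ka)$ for the limits of $T^k(y)$ and $\varphi(T^k(y))$ as $y\to a$ within $\omega$ (these limits exist). Suppose that $a$ is a non-trivial discontinuity, that is, $\{T^ka:k\ge1\}$ is an infinite set, and that $\varphi(a)\neq0$. Put $$\Lambda^{\inf}(T,\varphi,a)=\liminf_{n\to\infty}\Bigl|\prod_{k=1}^n\varphi(T^ka)\Bigr|^{1/n}.$$ Then the essential spectral radius of $\mathcal L_\varphi:\mathfrak B\to\mathfrak B$ is at least $\Lambda^{\inf}(T,\varphi,a)$. In fact, if $\Lambda^{\inf}(T,\varphi,a)>0$, the filled essential spectrum of $\mathcal L_\varphi:\mathfrak B\to\mathfrak B$ contains the closed disc of centre $0$ and radius $\Lambda^{\inf}(T,\varphi,a)$. Here the essential spectrum is the set of $z\in\mathbb C$ for which $z-\mathcal L_\varphi$ is not Fredholm, the essential spectral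 radius is the supremum of $|z|$ over it, and the filled essential spectrum is its union with the bounded components of its complement. -/

import Mathlib

open Set Filter Topology MeasureTheory

open scoped ContDiff ENNReal

noncomputable section

/-! ### Piecewise monotone transformations of `[0,1]` -/

/-- The open interval `ω_l = (c_l, c_{l+1})` cut out by the points `c_0 < c_1 < ⋯ < c_N`. -/
def branch {N : ℕ} (c : Fin (N + 1) → unitInterval) (l : Fin N) : Set unitInterval :=
  Ioo (c l.castSucc) (c l.succ)

/-- The points `0 = c_0 < ⋯ < c_N = 1` cut `[0,1]` into open intervals on each of which `T` is
continuous and strictly monotone.  Nothing is asked of the values of `T` at the points `c_l`. -/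
structure IsMonotonePartition (T : unitInterval → unitInterval) {N : ℕ}
    (c : Fin (N + 1) → unitInterval) : Prop where
  strictMono : StrictMono c
  first : c 0 = 0
  last : c (Fin.last N) = 1
  continuousOn : ∀ l, ContinuousOn T (branch c l)
  monotoneOn : ∀ l, StrictMonoOn T (branch c l) ∨ StrictAntiOn T (branch c l)

/-- The partition is maximal: its intervals are as large as possible, that is, no partition of the
same kind has fewer cut points. -/
structure IsMaximalMonotonePartition (T : unitInterval → unitInterval) {N : ℕ}
    (c : Fin (N + 1) → unitInterval) : Prop extends IsMonotonePartition T c where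
  maximal : ∀ (M : ℕ) (d : Fin (M + 1) → unitInterval),
    IsMonotonePartition T d → range d ⊆ range c → range d = range c

/-- `φ` is continuous on each `ω_l`, with a continuous extension to the closure of `ω_l`. -/
def IsPiecewiseContinuous {N : ℕ} (c : Fin (N + 1) → unitInterval) (φ : unitInterval → ℂ) :
    Prop :=
  ∀ l, ∃ g : unitInterval → ℂ, ContinuousOn g (closure (branch c l)) ∧ EqOn φ g (branch c l)

/-- The functions that are smooth on each `ω_l` up to the boundary of `ω_l`; the values at the
points `c_l` are arbitrary. -/
def piecewiseSmooth {N : ℕ} (c : Fin (N + 1) → unitInterval) : Set (unitInterval → ℂ) :=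
  {h | ∀ l, ∃ g : ℝ → ℂ, ContDiff ℝ ∞ g ∧ ∀ x ∈ branch c l, h x = g x}

/-! ### The transfer operator -/

/-- The transfer operator
`h ↦ ∑_l (φ · h) ∘ (T|_{ω_l})⁻¹ · 𝟙_{T ω_l}`, acting pointwise on all functions `[0,1] → ℂ`. -/
def transfer (T : unitInterval → unitInterval) {N : ℕ} (c : Fin (N + 1) → unitInterval)
    (φ : unitInterval → ℂ) : (unitInterval → ℂ) →ₗ[ℂ] (unitInterval → ℂ) where
  toFun h := ∑ l : Fin N, (T '' branch c l).indicator
    ((fun x => φ x * h x) ∘ Function.invFunOn T (branch c l))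
  map_add' h₁ h₂ := by
    rw [← Finset.sum_add_distrib]
    refine Finset.sum_congr rfl fun l _ => ?_
    rw [← indicator_add']
    congr 1
    funext x
    simp [mul_add]
  map_smul' r h := by
    rw [Finset.smul_sum]
    refine Finset.sum_congr rfl fun l _ => ?_
    funext y
    by_cases hy : y ∈ T '' branch c l
    · simp [hy, mul_left_comm]
    · simp [hy]

/-- The linear span of all the iterates `L^n h`, `n ≥ 0`, of piecewise smooth functions `h` under
the transfer operator `L`. -/
def iterateSpan (T : unitInterval → unitInterval) {N : ℕ} (c : Fin (N + 1) → unitInterval)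
    (φ : unitInterval → ℂ) : Submodule ℂ (unitInterval → ℂ) :=
  Submodule.span ℂ (⋃ n : ℕ, (⇑(transfer T c φ))^[n] '' piecewiseSmooth c)

theorem transfer_mem_iterateSpan (T : unitInterval → unitInterval) {N : ℕ}
    (c : Fin (N + 1) → unitInterval) (φ : unitInterval → ℂ) :
    ∀ h ∈ iterateSpan T c φ, transfer T c φ h ∈ iterateSpan T c φ := by
  intro h hh
  suffices iterateSpan T c φ ≤ (iterateSpan T c φ).comap (transfer T c φ) from this hh
  refine Submodule.span_le.2 ?_
  rintro _ ⟨_, ⟨n, rfl⟩, f, hf, rfl⟩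
  refine Submodule.subset_span (mem_iUnion.2 ⟨n + 1, f, hf, ?_⟩)
  rw [Function.iterate_succ_apply']

/-- The transfer operator as an endomorphism of `iterateSpan`. -/
def transferOnSpan (T : unitInterval → unitInterval) {N : ℕ} (c : Fin (N + 1) → unitInterval)
    (φ : unitInterval → ℂ) : iterateSpan T c φ →ₗ[ℂ] iterateSpan T c φ :=
  (transfer T c φ).restrict (transfer_mem_iterateSpan T c φ)

/-! ### Orbits of boundary points

A boundary point `a` of `ω_l` is regarded as a point of the disjoint union of the closures of the
intervals, so that everything at `a` is a limit taken from within `ω_l`. -/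

/-- The point `T^k a`, for `a ∈ ∂ω_l`: the limit of `T^k y` as `y → a` within `ω_l`.  For a
piecewise monotone `T` the limit exists, see `tendsto_boundaryOrbit`. -/
def boundaryOrbit (T : unitInterval → unitInterval) {N : ℕ} (c : Fin (N + 1) → unitInterval)
    (l : Fin N) (a : unitInterval) (k : ℕ) : unitInterval :=
  limUnder (𝓝[branch c l] a) (T^[k])

/-- The number `φ(T^k a)`, for `a ∈ ∂ω_l`: the limit of `φ(T^k y)` as `y → a` within `ω_l`.  This
is the value of `φ` at `T^k a` if `T^k a` is not one of the points `c_j`, and the value of the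
continuous extension of `φ` from the appropriate side otherwise.  The limit exists, see
`tendsto_boundaryWeight`. -/
def boundaryWeight (T : unitInterval → unitInterval) {N : ℕ} (c : Fin (N + 1) → unitInterval)
    (φ : unitInterval → ℂ) (l : Fin N) (a : unitInterval) (k : ℕ) : ℂ :=
  limUnder (𝓝[branch c l] a) (fun y => φ (T^[k] y))

/-- `liminf_{n → ∞} |∏_{k=1}^n φ(T^k a)|^{1/n}`. -/
def lambdaInf (T : unitInterval → unitInterval) {N : ℕ} (c : Fin (N + 1) → unitInterval)
    (φ : unitInterval → ℂ) (l : Fin N) (a : unitInterval) : ℝ :=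
  liminf (fun n : ℕ => ‖∏ k ∈ Finset.Icc 1 n, boundaryWeight T c φ l a k‖ ^ (1 / (n : ℝ))) atTop

/-- `a ∈ ∂ω_l` is a non-trivial discontinuity: the set `{T^k a : k ≥ 1}` is infinite. -/
def IsNontrivialDiscontinuity (T : unitInterval → unitInterval) {N : ℕ}
    (c : Fin (N + 1) → unitInterval) (l : Fin N) (a : unitInterval) : Prop :=
  a ∈ frontier (branch c l) ∧ (boundaryOrbit T c l a '' Ici 1).Infinite

/-! ### Essential spectrum -/

section EssentialSpectrum

variable {B : Type*} [NormedAddCommGroup B] [NormedSpace ℂ B]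

/-- The essential spectrum: the `z` for which `z - A` is not a Fredholm operator. -/
def essSpectrum (A : B →L[ℂ] B) : Set ℂ :=
  {z | ¬ (z • ContinuousLinearMap.id ℂ B - A).IsFredholm}

/-- The union of the essential spectrum and of all the bounded components of its complement. -/
def filledEssSpectrum (A : B →L[ℂ] B) : Set ℂ :=
  essSpectrum A ∪
    {z | z ∉ essSpectrum A ∧ Bornology.IsBounded (connectedComponentIn (essSpectrum A)ᶜ z)}

/-- The essential spectral radius, the supremum of `|z|` over the essential spectrum. -/
def essSpectralRadius (A : B →L[ℂ] B) : ℝ≥0∞ :=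
  ⨆ z ∈ essSpectrum A, ‖z‖ₑ

end EssentialSpectrum

/-! ### The limits in the definition of the orbit of a boundary point exist -/

theorem nhdsWithin_branch {N : ℕ} {c : Fin (N + 1) → unitInterval} (hc : StrictMono c)
    {l : Fin N} {a : unitInterval} (ha : a ∈ frontier (branch c l)) :
    (𝓝[branch c l] a = 𝓝[>] a ∧ (𝓝[>] a).NeBot) ∨
      (𝓝[branch c l] a = 𝓝[<] a ∧ (𝓝[<] a).NeBot) := by
  have h : c l.castSucc < c l.succ := hc (Fin.castSucc_lt_succ (i := l))
  rw [branch, frontier_Ioo h] at ha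
  rcases ha with rfl | rfl
  · exact Or.inl ⟨nhdsWithin_Ioo_eq_nhdsGT h, nhdsGT_neBot_of_exists_gt ⟨_, h⟩⟩
  · exact Or.inr ⟨nhdsWithin_Ioo_eq_nhdsLT h, nhdsLT_neBot_of_exists_lt ⟨_, h⟩⟩

theorem exists_branch_gt {T : unitInterval → unitInterval} {N : ℕ}
    {c : Fin (N + 1) → unitInterval} (h : IsMonotonePartition T c) {x : unitInterval}
    (hx : x < 1) : ∃ j : Fin N, x ∈ closure (branch c j) ∧ ∃ b, x < b ∧ Ioo x b ⊆ branch c j := by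
  have h1 : ∃ i : Fin (N + 1), x < c i := ⟨Fin.last N, by rwa [h.last]⟩
  obtain ⟨i, hi, hmin⟩ : ∃ i : Fin (N + 1), x < c i ∧ ∀ j < i, ¬ x < c j := by
    obtain ⟨i, hi⟩ := h1
    induction i using Fin.induction with
    | zero => exact ⟨0, hi, fun j hj => absurd hj (Fin.not_lt_zero j)⟩
    | succ i ih =>
      by_cases hh : x < c i.castSucc
      · exact ih hh
      · refine ⟨i.succ, hi, fun j hj hxj => hh (hxj.trans_le (h.strictMono.monotone ?_))⟩
        exact Fin.le_castSucc_iff.2 hj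
  have hi0 : i ≠ 0 := by
    rintro rfl
    rw [h.first] at hi
    exact absurd hi (not_lt.2 unitInterval.nonneg')
  obtain ⟨j, rfl⟩ := Fin.exists_succ_eq.2 hi0
  have hj : c j.castSucc ≤ x := not_lt.1 (hmin _ (Fin.castSucc_lt_succ (i := j)))
  refine ⟨j, ?_, c j.succ, hi, Ioo_subset_Ioo_left hj⟩
  rw [branch, closure_Ioo (hj.trans_lt hi).ne]
  exact ⟨hj, hi.le⟩

theorem exists_branch_lt {T : unitInterval → unitInterval} {N : ℕ}
    {c : Fin (N + 1) → unitInterval} (h : IsMonotonePartition T c) {x : unitInterval}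
    (hx : 0 < x) : ∃ j : Fin N, x ∈ closure (branch c j) ∧ ∃ b, b < x ∧ Ioo b x ⊆ branch c j := by
  have h1 : ∃ i : Fin (N + 1), x ≤ c i := ⟨Fin.last N, by rw [h.last]; exact unitInterval.le_one'⟩
  obtain ⟨i, hi, hmin⟩ : ∃ i : Fin (N + 1), x ≤ c i ∧ ∀ j < i, ¬ x ≤ c j := by
    obtain ⟨i, hi⟩ := h1
    induction i using Fin.induction with
    | zero => exact ⟨0, hi, fun j hj => absurd hj (Fin.not_lt_zero j)⟩
    | succ i ih =>
      by_cases hh : x ≤ c i.castSucc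
      · exact ih hh
      · refine ⟨i.succ, hi, fun j hj hxj => hh (hxj.trans (h.strictMono.monotone ?_))⟩
        exact Fin.le_castSucc_iff.2 hj
  have hi0 : i ≠ 0 := by
    rintro rfl
    rw [h.first] at hi
    exact absurd hi (not_le.2 hx)
  obtain ⟨j, rfl⟩ := Fin.exists_succ_eq.2 hi0
  have hj : c j.castSucc < x := not_le.1 (hmin _ (Fin.castSucc_lt_succ (i := j)))
  refine ⟨j, ?_, c j.castSucc, hj, Ioo_subset_Ioo_right hi⟩
  rw [branch, closure_Ioo (hj.trans_le hi).ne]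
  exact ⟨hj.le, hi⟩

theorem tendsto_step_gt {f : unitInterval → unitInterval} {x b : unitInterval} (hb : x < b)
    (hf : StrictMonoOn f (Ioo x b) ∨ StrictAntiOn f (Ioo x b)) :
    ∃ y, Tendsto f (𝓝[>] x) (𝓝[>] y) ∨ Tendsto f (𝓝[>] x) (𝓝[<] y) := by
  have hne : (Ioo x b).Nonempty := nonempty_Ioo.2 hb
  rcases hf with hf | hf
  · have h1 := hf.monotoneOn.tendsto_nhdsWithin_Ioo_right hne (OrderBot.bddBelow _)
    refine ⟨_, Or.inl (tendsto_nhdsWithin_iff.2 ⟨h1, ?_⟩)⟩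
    filter_upwards [Ioo_mem_nhdsGT hb] with w hw
    obtain ⟨v, hv⟩ := exists_between hw.1
    exact (csInf_le (OrderBot.bddBelow _)
      (mem_image_of_mem f (⟨hv.1, hv.2.trans hw.2⟩ : v ∈ Ioo x b))).trans_lt
        (hf ⟨hv.1, hv.2.trans hw.2⟩ hw hv.2)
  · have h1 := hf.antitoneOn.tendsto_nhdsWithin_Ioo_right hne (OrderTop.bddAbove _)
    refine ⟨_, Or.inr (tendsto_nhdsWithin_iff.2 ⟨h1, ?_⟩)⟩
    filter_upwards [Ioo_mem_nhdsGT hb] with w hw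
    obtain ⟨v, hv⟩ := exists_between hw.1
    exact (hf ⟨hv.1, hv.2.trans hw.2⟩ hw hv.2).trans_le (le_csSup (OrderTop.bddAbove _)
      (mem_image_of_mem f (⟨hv.1, hv.2.trans hw.2⟩ : v ∈ Ioo x b)))

theorem tendsto_step_lt {f : unitInterval → unitInterval} {x b : unitInterval} (hb : b < x)
    (hf : StrictMonoOn f (Ioo b x) ∨ StrictAntiOn f (Ioo b x)) :
    ∃ y, Tendsto f (𝓝[<] x) (𝓝[>] y) ∨ Tendsto f (𝓝[<] x) (𝓝[<] y) := by
  have hne : (Ioo b x).Nonempty := nonempty_Ioo.2 hb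
  rcases hf with hf | hf
  · have h1 := hf.monotoneOn.tendsto_nhdsWithin_Ioo_left hne (OrderTop.bddAbove _)
    refine ⟨_, Or.inr (tendsto_nhdsWithin_iff.2 ⟨h1, ?_⟩)⟩
    filter_upwards [Ioo_mem_nhdsLT hb] with w hw
    obtain ⟨v, hv⟩ := exists_between hw.2
    exact (hf hw ⟨hw.1.trans hv.1, hv.2⟩ hv.1).trans_le (le_csSup (OrderTop.bddAbove _)
      (mem_image_of_mem f (⟨hw.1.trans hv.1, hv.2⟩ : v ∈ Ioo b x)))
  · have h1 := hf.antitoneOn.tendsto_nhdsWithin_Ioo_left hne (OrderBot.bddBelow _)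
    refine ⟨_, Or.inl (tendsto_nhdsWithin_iff.2 ⟨h1, ?_⟩)⟩
    filter_upwards [Ioo_mem_nhdsLT hb] with w hw
    obtain ⟨v, hv⟩ := exists_between hw.2
    exact (csInf_le (OrderBot.bddBelow _)
      (mem_image_of_mem f (⟨hw.1.trans hv.1, hv.2⟩ : v ∈ Ioo b x))).trans_lt
        (hf hw ⟨hw.1.trans hv.1, hv.2⟩ hv.1)

theorem lt_one_of_nhdsGT_neBot {x : unitInterval} (h : (𝓝[>] x).NeBot) : x < 1 := by
  refine lt_of_le_of_ne unitInterval.le_one' ?_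
  rintro rfl
  have h0 : Ioi (1 : unitInterval) = ∅ :=
    eq_empty_of_forall_notMem fun y hy => absurd hy (not_lt.2 unitInterval.le_one')
  rw [h0, nhdsWithin_empty] at h
  exact h.ne rfl

theorem pos_of_nhdsLT_neBot {x : unitInterval} (h : (𝓝[<] x).NeBot) : 0 < x := by
  refine lt_of_le_of_ne unitInterval.nonneg' ?_
  rintro rfl
  have h0 : Iio (0 : unitInterval) = ∅ :=
    eq_empty_of_forall_notMem fun y hy => absurd hy (not_lt.2 unitInterval.nonneg')
  rw [h0, nhdsWithin_empty] at h
  exact h.ne rfl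

/-- Near a boundary point, each iterate is one-sided: it lands on one side of its limit. -/
theorem exists_tendsto_iterate {T : unitInterval → unitInterval} {N : ℕ}
    {c : Fin (N + 1) → unitInterval} (h : IsMonotonePartition T c) {l : Fin N} {a : unitInterval}
    (ha : a ∈ frontier (branch c l)) (k : ℕ) :
    ∃ y, Tendsto (T^[k]) (𝓝[branch c l] a) (𝓝[>] y) ∨
      Tendsto (T^[k]) (𝓝[branch c l] a) (𝓝[<] y) := by
  have hF : (𝓝[branch c l] a).NeBot := by
    rcases nhdsWithin_branch h.strictMono ha with ⟨e, hn⟩ | ⟨e, hn⟩ <;> rwa [e]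
  induction k with
  | zero =>
    refine ⟨a, ?_⟩
    rcases nhdsWithin_branch h.strictMono ha with ⟨e, -⟩ | ⟨e, -⟩
    · exact Or.inl (e ▸ tendsto_id)
    · exact Or.inr (e ▸ tendsto_id)
  | succ k ih =>
    rw [Function.iterate_succ']
    obtain ⟨x, hx | hx⟩ := ih
    · obtain ⟨j, -, b, hb, hsub⟩ := exists_branch_gt h (lt_one_of_nhdsGT_neBot hx.neBot)
      obtain ⟨y, hy⟩ := tendsto_step_gt hb ((h.monotoneOn j).imp (·.mono hsub) (·.mono hsub))
      exact ⟨y, hy.imp (·.comp hx) (·.comp hx)⟩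
    · obtain ⟨j, -, b, hb, hsub⟩ := exists_branch_lt h (pos_of_nhdsLT_neBot hx.neBot)
      obtain ⟨y, hy⟩ := tendsto_step_lt hb ((h.monotoneOn j).imp (·.mono hsub) (·.mono hsub))
      exact ⟨y, hy.imp (·.comp hx) (·.comp hx)⟩

theorem tendsto_boundaryOrbit {T : unitInterval → unitInterval} {N : ℕ}
    {c : Fin (N + 1) → unitInterval} (h : IsMonotonePartition T c) {l : Fin N} {a : unitInterval}
    (ha : a ∈ frontier (branch c l)) (k : ℕ) :
    Tendsto (T^[k]) (𝓝[branch c l] a) (𝓝 (boundaryOrbit T c l a k)) := by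
  obtain ⟨y, hy⟩ := exists_tendsto_iterate h ha k
  refine tendsto_nhds_limUnder ⟨y, ?_⟩
  rcases hy with hy | hy <;> exact hy.mono_right nhdsWithin_le_nhds

theorem tendsto_boundaryWeight {T : unitInterval → unitInterval} {N : ℕ}
    {c : Fin (N + 1) → unitInterval} (h : IsMonotonePartition T c) {φ : unitInterval → ℂ}
    (hφ : IsPiecewiseContinuous c φ) {l : Fin N} {a : unitInterval}
    (ha : a ∈ frontier (branch c l)) (k : ℕ) :
    Tendsto (fun y => φ (T^[k] y)) (𝓝[branch c l] a) (𝓝 (boundaryWeight T c φ l a k)) := by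
  have hF : (𝓝[branch c l] a).NeBot := by
    rcases nhdsWithin_branch h.strictMono ha with ⟨e, hn⟩ | ⟨e, hn⟩ <;> rwa [e]
  refine tendsto_nhds_limUnder ?_
  have key : ∀ (x : unitInterval) (j : Fin N), x ∈ closure (branch c j) →
      ∃ z, Tendsto φ (𝓝[branch c j] x) (𝓝 z) := by
    intro x j hx
    obtain ⟨g, hg, he⟩ := hφ j
    refine ⟨g x, ((hg x hx).mono_left (nhdsWithin_mono _ subset_closure)).congr' ?_⟩
    filter_upwards [self_mem_nhdsWithin] with w hw using (he hw).symm
  obtain ⟨x, hx | hx⟩ := exists_tendsto_iterate h ha k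
  · obtain ⟨j, hj, b, hb, hsub⟩ := exists_branch_gt h (lt_one_of_nhdsGT_neBot hx.neBot)
    obtain ⟨z, hz⟩ := key x j hj
    have : 𝓝[>] x ≤ 𝓝[branch c j] x := by
      rw [← nhdsWithin_Ioo_eq_nhdsGT hb]
      exact nhdsWithin_mono _ hsub
    exact ⟨z, (hz.mono_left this).comp hx⟩
  · obtain ⟨j, hj, b, hb, hsub⟩ := exists_branch_lt h (pos_of_nhdsLT_neBot hx.neBot)
    obtain ⟨z, hz⟩ := key x j hj
    have : 𝓝[<] x ≤ 𝓝[branch c j] x := by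
      rw [← nhdsWithin_Ioo_eq_nhdsLT hb]
      exact nhdsWithin_mono _ hsub
    exact ⟨z, (hz.mono_left this).comp hx⟩

end

/-!
The spectrum that the theorem asserts is produced by jumps.  Write `x_k = T^k a`.  Since `a` is a
non-trivial discontinuity, the one-sided points `x_k` are all distinct, so that for large `k` they
avoid the cut points, and no boundary orbit enters the orbit `(x_k)` other than along it
(`exists_forall_boundaryOrbit_eq`).  The functions in the span of the iterates have one-sided limits
everywhere and jump only on the boundary orbits (`iterateSpan_regular`).  Hence, for large `k`, the
jump of `ℒ h` at `x_{k+1}` is `± φ(x_k)` times the jump of `h` at `x_k` (`exists_hasJump_transfer`).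
The norm dominates the essential supremum, so that the jumps at the points `x_k` are restrictions of
functionals `ψ_k` on the Banach space, with a common bound (`exists_jump_functional`).

Suppose that a point `z₀` of the closed disc of radius `Λ` is not in the filled essential spectrum.
Then it lies in an unbounded connected set `U` on which `z - ℒ` is Fredholm.  A determinant argument
shows that the spectrum is discrete in `U` (`eventually_mem_resolventSet`), and the identity theorem
that there the resolvent preserves the closure of the span of the iterates, since it does far away
(`eventually_resolvent_apply_mem`).  Let `h` be piecewise smooth, without jump at the points `x_k`,
and let `g = (z - ℒ)⁻¹ h`.  Then `z ψ_{k+1}(g) = ± φ(x_k) ψ_k(g)`.  For `|z| < Λ` the products of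
the `φ(x_k)` outgrow the powers of `z`, and the boundedness of `ψ_k(g)` forces `ψ_k(g) = 0`.  By the
identity theorem `ψ_k((z - ℒ)⁻¹ h) = 0` also for large `z`, so that `ψ_k(ℒ^n h) = 0` for all `n`
(`apply_pow_eq_zero_of_notMem_filledEssSpectrum`).  This fails for `n = k` and a bump function `h`
concentrated near `a` within `ω`, for which the jump of `ℒ^k h` at `x_k` is `± ∏_{j<k} φ(x_j)`,
where `x_0 = a` (`exists_hasJump_iterate`).
-/

/-! ### Linear pencils through a Fredholm operator -/

/-- Schur complement: if `A` maps `X₁` isomorphically onto the first factor of a decomposition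
`G` of the codomain, then `A` is bijective as soon as the induced map from a complement `X₀` of
`X₁` to the second factor is, and conversely. -/
theorem bijective_iff_bijective_schur {𝕜 V W Y : Type*} [Field 𝕜] [AddCommGroup V] [Module 𝕜 V]
    [AddCommGroup W] [Module 𝕜 W] [AddCommGroup Y] [Module 𝕜 Y] {X₁ X₀ : Submodule 𝕜 V}
    (h : IsCompl X₁ X₀) (A : V →ₗ[𝕜] W) (G : W ≃ₗ[𝕜] X₁ × Y) (hG : ∀ x : X₁, G (A x) = (x, 0)) :
    Function.Bijective A ↔ Function.Bijective fun x : X₀ => (G (A x)).2 := by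
  have key : ∀ (x₁ : X₁) (x₀ : X₀), G (A (x₁ + x₀)) = (x₁ + (G (A x₀)).1, (G (A x₀)).2) := by
    intro x₁ x₀
    rw [map_add, map_add, hG]
    ext <;> simp
  have dec : ∀ x : V, ∃ (x₁ : X₁) (x₀ : X₀), x = x₁ + x₀ := fun x => by
    obtain ⟨a, b, hab, -⟩ := Submodule.existsUnique_add_of_isCompl h x
    exact ⟨a, b, hab.symm⟩
  constructor
  · rintro ⟨hi, hs⟩
    have hi' := (injective_iff_map_eq_zero A).1 hi
    constructor
    · refine (injective_iff_map_eq_zero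
        ((LinearMap.snd 𝕜 X₁ Y) ∘ₗ G.toLinearMap ∘ₗ A ∘ₗ X₀.subtype)).2 fun x hx => ?_
      have hx : (G (A x)).2 = 0 := hx
      have h1 : A ((-(G (A x)).1 : X₁) + x) = 0 := by
        apply G.injective
        rw [key, hx, map_zero]
        ext <;> simp
      have h2 := hi' _ h1
      have h3 : (x : V) ∈ X₁ := by
        rw [eq_neg_of_add_eq_zero_right h2]
        exact X₁.neg_mem (Subtype.prop _)
      exact Subtype.ext (Submodule.disjoint_def.1 h.disjoint _ h3 x.2)
    · intro q
      obtain ⟨b, hb⟩ := hs (G.symm (0, q))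
      obtain ⟨x₁, x₀, rfl⟩ := dec b
      refine ⟨x₀, ?_⟩
      have := congrArg G hb
      rw [key, G.apply_symm_apply] at this
      exact congrArg Prod.snd this
  · rintro ⟨hi, hs⟩
    constructor
    · refine (injective_iff_map_eq_zero A).2 fun b hb => ?_
      obtain ⟨x₁, x₀, rfl⟩ := dec b
      have h1 := key x₁ x₀
      rw [hb, map_zero] at h1
      have h2 : (G (A x₀)).2 = 0 := (congrArg Prod.snd h1).symm
      have h3 : x₀ = 0 := hi (by simpa using h2)
      subst h3
      have h4 : x₁ = 0 := by simpa using (congrArg Prod.fst h1).symm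
      simp [h4]
    · intro t
      obtain ⟨x₀, hx₀⟩ := hs (G t).2
      refine ⟨((G t).1 - (G (A x₀)).1 : X₁) + x₀, G.injective ?_⟩
      rw [key]
      exact Prod.ext (by simp) hx₀

theorem eventually_isUnit_one_add_smul {E : Type*} [NormedAddCommGroup E] [NormedSpace ℂ E]
    [CompleteSpace E] (K : E →L[ℂ] E) :
    (∀ᶠ δ in 𝓝 (0 : ℂ), IsUnit (1 + δ • K)) ∧
      ∀ δ : ℂ, IsUnit (1 + δ • K) → ∀ x,
        DifferentiableAt ℂ (fun δ : ℂ => Ring.inverse (1 + δ • K) x) δ := by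
  constructor
  · have hc : Continuous fun δ : ℂ => 1 + δ • K := by fun_prop
    have h0 : IsUnit (1 + (0 : ℂ) • K) := by simp
    exact hc.continuousAt (Units.isOpen.mem_nhds h0)
  · intro δ h x
    have hP : DifferentiableAt ℂ (fun δ : ℂ => 1 + δ • K) δ := by fun_prop
    exact ((differentiableAt_inverse (𝕜 := ℂ) h).comp δ hP).clm_apply (differentiableAt_const x)

/-- A linear pencil through a Fredholm operator is, near that operator, either never invertible or
invertible except at the operator itself: its invertibility is that of an analytic family of
linear maps between spaces of finite dimension, which is decided by a determinant. -/
theorem ContinuousLinearMap.IsFredholm.eventually_bijective_or {B : Type*} [NormedAddCommGroup B]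
    [NormedSpace ℂ B] [CompleteSpace B] {u : B →L[ℂ] B} (hu : u.IsFredholm) (v : B →L[ℂ] B) :
    (∀ᶠ δ in 𝓝[≠] (0 : ℂ), Function.Bijective (u + δ • v : B →L[ℂ] B)) ∨
      ∀ᶠ δ in 𝓝[≠] (0 : ℂ), ¬ Function.Bijective (u + δ • v : B →L[ℂ] B) := by
  obtain ⟨pkg⟩ := hu.nonempty_fredholmPackage
  set X₁ := pkg.decDom.X₁
  set X₀ := pkg.decDom.X₀
  set Y₀ := pkg.decCodom.X₀
  have : FiniteDimensional ℂ X₀ := pkg.decDom.finite_X₀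
  have : FiniteDimensional ℂ Y₀ := pkg.decCodom.finite_X₀
  have : CompleteSpace X₁ := pkg.decDom.isTopCompl.isClosed.completeSpace_coe
  have : CompleteSpace Y₀ := FiniteDimensional.complete ℂ Y₀
  -- `u` on a complement of its kernel, together with a complement of its range
  let Q : (X₁ × Y₀) ≃L[ℂ] B := (pkg.equiv.prodCongr (.refl ℂ Y₀)).trans
    (Submodule.prodEquivOfIsTopCompl _ _ pkg.decCodom.isTopCompl)
  have hQ : ∀ x : X₁, Q (x, 0) = u x := by
    intro x
    have h : (pkg.equiv x : B) = u x := by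
      rw [← ContinuousLinearEquiv.coe_coe, pkg.equiv_eq_restrict]
      rfl
    rw [← h]
    simp [Q, Submodule.prodEquivOfIsTopCompl_apply]
  have hker : ∀ x : X₀, u x = 0 := by
    intro x
    have h : (x : B) ∈ u.ker := by
      rw [pkg.ker_eq]
      exact x.2
    exact h
  -- `Q * (1 + δ • K)` is the restriction of `u + δ • v` to `X₁`, together with `Y₀`
  let K : (X₁ × Y₀) →L[ℂ] (X₁ × Y₀) :=
    (Q.symm : B →L[ℂ] X₁ × Y₀) ∘L v ∘L X₁.subtypeL ∘L ContinuousLinearMap.fst ℂ X₁ Y₀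
  let P : ℂ → (X₁ × Y₀) →L[ℂ] (X₁ × Y₀) := fun δ => 1 + δ • K
  obtain ⟨hPu, hPd⟩ := eventually_isUnit_one_add_smul K
  -- the Schur complement
  let D : ℂ → X₀ →ₗ[ℂ] Y₀ := fun δ => δ • ((ContinuousLinearMap.snd ℂ X₁ Y₀) ∘L
    Ring.inverse (P δ) ∘L (Q.symm : B →L[ℂ] X₁ × Y₀) ∘L v ∘L X₀.subtypeL : X₀ →L[ℂ] Y₀)
  have hD : ∀ δ, IsUnit (P δ) →
      (Function.Bijective (u + δ • v : B →L[ℂ] B) ↔ Function.Bijective (D δ)) := by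
    intro δ h
    let e : (X₁ × Y₀) ≃L[ℂ] (X₁ × Y₀) := ContinuousLinearEquiv.ofUnit h.unit
    have he : ∀ x, e x = P δ x := fun x => rfl
    have he' : ∀ x, e.symm x = Ring.inverse (P δ) x := by
      intro x
      rw [← h.unit_spec, Ring.inverse_unit]
      rfl
    let G : B ≃L[ℂ] (X₁ × Y₀) := Q.symm.trans e.symm
    have hG : ∀ x : X₁, G ((u + δ • v) x) = (x, 0) := by
      intro x
      change e.symm (Q.symm _) = _
      rw [ContinuousLinearEquiv.symm_apply_eq, he, ContinuousLinearEquiv.symm_apply_eq]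
      simp [P, K, hQ]
    have := bijective_iff_bijective_schur pkg.decDom.isTopCompl.isCompl
      ((u + δ • v : B →L[ℂ] B) : B →ₗ[ℂ] B) G.toLinearEquiv hG
    refine this.trans (iff_of_eq (congrArg _ (funext fun x => ?_)))
    change (e.symm (Q.symm ((u + δ • v) x))).2 = _
    rw [he']
    simp [D, hker]
  by_cases hdim : Module.finrank ℂ X₀ = Module.finrank ℂ Y₀
  · let e : Y₀ ≃ₗ[ℂ] X₀ := LinearEquiv.ofFinrankEq _ _ hdim.symm
    let b := Module.finBasis ℂ X₀
    let d : ℂ → ℂ := fun δ => Matrix.det (LinearMap.toMatrix b b (e.toLinearMap ∘ₗ D δ))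
    have hd : ∀ δ, Function.Bijective (D δ) ↔ d δ ≠ 0 := by
      intro δ
      rw [← isUnit_iff_ne_zero, show d δ = LinearMap.det (e.toLinearMap ∘ₗ D δ) from
        LinearMap.det_toMatrix _ _, ← LinearMap.isUnit_iff_isUnit_det, Module.End.isUnit_iff,
        LinearMap.coe_comp]
      exact (Function.Bijective.of_comp_iff' e.bijective _).symm
    have hda : AnalyticAt ℂ d 0 := by
      refine DifferentiableOn.analyticAt (s := {δ | IsUnit (P δ)}) ?_ hPu
      intro δ hδ
      refine DifferentiableAt.differentiableWithinAt ?_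
      simp only [d, Matrix.det_apply]
      have hent : ∀ i j, DifferentiableAt ℂ
          (fun δ => LinearMap.toMatrix b b (e.toLinearMap ∘ₗ D δ) i j) δ := by
        intro i j
        let φ : Y₀ →L[ℂ] ℂ := LinearMap.toContinuousLinearMap (b.coord i ∘ₗ e.toLinearMap)
        have : (fun δ => LinearMap.toMatrix b b (e.toLinearMap ∘ₗ D δ) i j) =
            fun δ => δ • φ (ContinuousLinearMap.snd ℂ X₁ Y₀ (Ring.inverse (P δ)
              (Q.symm (v (b j))))) := by
          funext δ
          simp [LinearMap.toMatrix_apply, D, φ]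
        rw [this]
        have h1 := hPd δ hδ (Q.symm (v (b j)))
        fun_prop
      fun_prop
    have hPu' : ∀ᶠ δ in 𝓝[≠] (0 : ℂ), IsUnit (P δ) := hPu.filter_mono nhdsWithin_le_nhds
    rcases hda.eventually_eq_zero_or_eventually_ne_zero with h | h
    · right
      filter_upwards [hPu', h.filter_mono nhdsWithin_le_nhds] with δ h1 h2
      rw [hD δ h1, hd δ]
      simpa using h2
    · left
      filter_upwards [hPu', h] with δ h1 h2
      rwa [hD δ h1, hd δ]
  · -- spaces of different dimensions are never isomorphic
    right
    filter_upwards [hPu.filter_mono nhdsWithin_le_nhds] with δ h1 h2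
    exact hdim (LinearEquiv.ofBijective (D δ) ((hD δ h1).1 h2)).finrank_eq

/-! ### Analytic continuation across isolated singularities -/

theorem isPreconnected_ball_diff_center (z : ℂ) {r : ℝ} (hr : 0 < r) :
    IsPreconnected (Metric.ball z r \ {z}) := by
  -- a punctured disc is the image of a half-plane under the exponential function
  have h : Metric.ball z r \ {z} = (fun w => z + Complex.exp w) '' {w | w.re < Real.log r} := by
    ext w
    simp only [Set.mem_sdiff, Metric.mem_ball, mem_singleton_iff, mem_image]
    constructor
    · rintro ⟨h1, h2⟩
      have h3 : w - z ≠ 0 := sub_ne_zero.2 h2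
      refine ⟨Complex.log (w - z), ?_, by rw [Complex.exp_log h3]; ring⟩
      change (Complex.log (w - z)).re < _
      rw [Complex.log_re]
      exact Real.log_lt_log (norm_pos_iff.2 h3) (by rwa [dist_eq_norm] at h1)
    · rintro ⟨v, hv, rfl⟩
      have hv : v.re < Real.log r := hv
      refine ⟨?_, by simp [Complex.exp_ne_zero]⟩
      rw [dist_eq_norm, add_sub_cancel_left, Complex.norm_exp]
      exact (Real.lt_log_iff_exp_lt hr).1 hv
  rw [h]
  exact (convex_halfSpace_re_lt _).isPreconnected.image _ (by fun_prop)

/-- The identity theorem on a punctured disc. -/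
theorem eventually_eq_zero_of_frequently {E : Type*} [NormedAddCommGroup E] [NormedSpace ℂ E]
    [CompleteSpace E] {f : ℂ → E} {S : Set ℂ} (hS : IsOpen S) (hf : DifferentiableOn ℂ f S) {z : ℂ}
    (hz : ∀ᶠ w in 𝓝[≠] z, w ∈ S) (h : ∃ᶠ w in 𝓝[≠] z, f =ᶠ[𝓝 w] 0) :
    ∀ᶠ w in 𝓝[≠] z, f w = 0 := by
  obtain ⟨r, hr, hrS⟩ := Metric.mem_nhdsWithin_iff.1 hz
  have hD : Metric.ball z r \ {z} ∈ 𝓝[≠] z :=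
    inter_mem (mem_nhdsWithin_of_mem_nhds (Metric.ball_mem_nhds z hr)) self_mem_nhdsWithin
  obtain ⟨w, hw0, hw⟩ := (h.and_eventually hD).exists
  have han : AnalyticOnNhd ℂ f (Metric.ball z r \ {z}) := fun x hx =>
    hf.analyticAt (hS.mem_nhds (hrS hx))
  have := han.eqOn_zero_of_preconnected_of_eventuallyEq_zero
    (isPreconnected_ball_diff_center z hr) hw hw0
  filter_upwards [hD] with x hx using this hx

/-- The points near which `p` holds, the point itself excepted, form an open set. -/
theorem isOpen_setOf_eventually_punctured {X : Type*} [TopologicalSpace X] [T1Space X]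
    (p : X → Prop) : IsOpen {z | ∀ᶠ w in 𝓝[≠] z, p w} := by
  rw [isOpen_iff_mem_nhds]
  intro x hx
  have h1 := eventually_eventually_nhdsWithin.2 (show ∀ᶠ w in 𝓝[≠] x, p w from hx)
  have h2 : ∀ᶠ y in 𝓝[≠] x, ∀ᶠ w in 𝓝[≠] y, p w := by
    filter_upwards [h1, self_mem_nhdsWithin] with y hy hyx
    rw [(isOpen_compl_singleton.nhdsWithin_eq hyx)] at hy
    exact hy.filter_mono nhdsWithin_le_nhds
  rw [eventually_nhdsWithin_iff] at h2
  filter_upwards [h2] with y hy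
  by_cases hyx : y = x
  · exact hyx ▸ hx
  · exact hy hyx

/-- The identity theorem on a connected set `U` for a function all of whose singularities in `U`
are isolated: it vanishes near `U`, up to isolated points, if it vanishes on an open set that
accumulates at a point of `U`. -/
theorem IsPreconnected.eventually_eq_zero_of_frequently {E : Type*} [NormedAddCommGroup E]
    [NormedSpace ℂ E] [CompleteSpace E] {f : ℂ → E} {S U : Set ℂ} (hU : IsPreconnected U)
    (hS : IsOpen S) (hf : DifferentiableOn ℂ f S) (hUS : ∀ z ∈ U, ∀ᶠ w in 𝓝[≠] z, w ∈ S)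
    {z₁ : ℂ} (hz₁ : z₁ ∈ U) (h : ∃ᶠ w in 𝓝[≠] z₁, f =ᶠ[𝓝 w] 0) {z : ℂ} (hz : z ∈ U) :
    ∀ᶠ w in 𝓝[≠] z, f w = 0 := by
  refine hU.subset_of_closure_inter_subset (isOpen_setOf_eventually_punctured fun w => f w = 0)
    ⟨z₁, hz₁, _root_.eventually_eq_zero_of_frequently hS hf (hUS z₁ hz₁) h⟩ ?_ hz
  rintro x ⟨hx, hxU⟩
  refine _root_.eventually_eq_zero_of_frequently hS hf (hUS x hxU) ?_
  rw [Filter.frequently_iff]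
  intro V hV
  obtain ⟨r, hr, hrV⟩ := Metric.mem_nhdsWithin_iff.1 hV
  obtain ⟨y, hyA, hy⟩ := Metric.mem_closure_iff.1 hx r hr |>.imp fun _ => id
  have hyr : y ∈ Metric.ball x r := by rwa [Metric.mem_ball']
  have hy1 : ∀ᶠ w in 𝓝[≠] y, w ≠ x := by
    rcases eq_or_ne y x with rfl | hne
    · exact self_mem_nhdsWithin
    · exact mem_nhdsWithin_of_mem_nhds (isOpen_ne.mem_nhds hne)
  have hy2 : ∀ᶠ w in 𝓝[≠] y, w ∈ Metric.ball x r :=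
    mem_nhdsWithin_of_mem_nhds (Metric.isOpen_ball.mem_nhds hyr)
  have hy3 : ∀ᶠ w in 𝓝[≠] y, f =ᶠ[𝓝 w] 0 := by
    have h1 := eventually_eventually_nhdsWithin.2 (show ∀ᶠ w in 𝓝[≠] y, f w = 0 from hyA)
    filter_upwards [h1, self_mem_nhdsWithin] with w hw hwy
    rwa [(isOpen_compl_singleton.nhdsWithin_eq hwy)] at hw
  obtain ⟨w, h1, h2, h3⟩ := (hy1.and (hy2.and hy3)).exists
  exact ⟨w, hrV ⟨h2, h1⟩, h3⟩

/-! ### The resolvent on the unbounded components of the Fredholm region -/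

section Resolvent

variable {B : Type*} [NormedAddCommGroup B] [NormedSpace ℂ B]

theorem mem_resolventSet_iff_bijective [CompleteSpace B] (L : B →L[ℂ] B) (z : ℂ) :
    z ∈ resolventSet ℂ L ↔ Function.Bijective (z • ContinuousLinearMap.id ℂ B - L) := by
  rw [← ContinuousLinearMap.isUnit_iff_bijective, spectrum.mem_resolventSet_iff,
    Algebra.algebraMap_eq_smul_one]
  rfl

theorem smul_resolvent_apply (L : B →L[ℂ] B) {z : ℂ} (hz : z ∈ resolventSet ℂ L) (x : B) :
    z • resolvent L z x = x + L (resolvent L z x) := by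
  have h : (algebraMap ℂ (B →L[ℂ] B) z - L) * resolvent L z = 1 := Ring.mul_inverse_cancel _ hz
  have h1 := DFunLike.congr_fun h x
  simp only [Algebra.algebraMap_eq_smul_one, mul_apply_eq_comp,
    sub_apply, smul_apply,
    one_apply_eq_self] at h1
  exact sub_eq_iff_eq_add.1 h1

theorem smul_resolvent_apply' (L : B →L[ℂ] B) {z : ℂ} (hz : z ∈ resolventSet ℂ L) (x : B) :
    z • resolvent L z x = x + resolvent L z (L x) := by
  have h : resolvent L z * (algebraMap ℂ (B →L[ℂ] B) z - L) = 1 := Ring.inverse_mul_cancel _ hz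
  have h1 := DFunLike.congr_fun h x
  simp only [Algebra.algebraMap_eq_smul_one, mul_apply_eq_comp,
    sub_apply, smul_apply,
    one_apply_eq_self, map_sub, map_smul] at h1
  exact sub_eq_iff_eq_add.1 h1

theorem differentiableOn_resolvent_apply [CompleteSpace B] {F : Type*} [NormedAddCommGroup F]
    [NormedSpace ℂ F]
    (L : B →L[ℂ] B) (x : B) (g : B →L[ℂ] F) :
    DifferentiableOn ℂ (fun z => g (resolvent L z x)) (resolventSet ℂ L) := by
  intro z hz
  have h := (spectrum.hasDerivAt_resolvent_const_left hz).differentiableAt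
  have h1 := h.clm_apply (differentiableAt_const x)
  exact (g.differentiableAt.comp z h1).differentiableWithinAt

/-- Far away from the origin, the resolvent preserves the closed invariant subspaces. -/
theorem resolvent_apply_mem [CompleteSpace B] {L : B →L[ℂ] B} {E : Submodule ℂ B}
    (hE : IsClosed (E : Set B)) (hLE : ∀ x ∈ E, L x ∈ E) {z : ℂ} (hz : z ∈ resolventSet ℂ L)
    (hzL : ‖L‖ < ‖z‖) {x : B} (hx : x ∈ E) : resolvent L z x ∈ E := by
  have : CompleteSpace E := hE.completeSpace_coe
  let A : E →L[ℂ] E := L.restrict hLE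
  have hA : ‖A‖ ≤ ‖L‖ := ContinuousLinearMap.opNorm_le_bound _ (norm_nonneg _) fun y =>
    L.le_opNorm y
  have hzA : z ∈ resolventSet ℂ A := by
    refine spectrum.mem_resolventSet_of_norm_lt_mul (a := A) (lt_of_le_of_lt ?_ hzL)
    calc ‖A‖ * ‖(1 : E →L[ℂ] E)‖ ≤ ‖L‖ * 1 :=
          mul_le_mul hA ContinuousLinearMap.norm_id_le
            (ContinuousLinearMap.opNorm_nonneg _) (norm_nonneg _)
      _ = ‖L‖ := mul_one _
  have h := (mem_resolventSet_iff_bijective A z).1 hzA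
  obtain ⟨y, hy⟩ := h.2 ⟨x, hx⟩
  have h1 : (z • ContinuousLinearMap.id ℂ B - L) y = x := congrArg Subtype.val hy
  have h2 : resolvent L z x = y := by
    rw [← h1]
    have := smul_resolvent_apply' L hz (y : B)
    simp only [sub_apply, smul_apply,
      ContinuousLinearMap.id_apply, map_sub, map_smul, this]
    abel
  rw [h2]
  exact y.2

/-- On a connected unbounded set of points `z` for which `z - L` is Fredholm, the spectrum of `L`
is discrete. -/
theorem eventually_mem_resolventSet [CompleteSpace B] {L : B →L[ℂ] B} {U : Set ℂ}
    (hU : IsPreconnected U) (hUF : ∀ z ∈ U, (z • ContinuousLinearMap.id ℂ B - L).IsFredholm)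
    (hUb : ¬ Bornology.IsBounded U) {z : ℂ} (hz : z ∈ U) :
    ∀ᶠ w in 𝓝[≠] z, w ∈ resolventSet ℂ L := by
  have hdich : ∀ z ∈ U, (∀ᶠ w in 𝓝[≠] z, w ∈ resolventSet ℂ L) ∨
      ∀ᶠ w in 𝓝[≠] z, w ∉ resolventSet ℂ L := by
    intro z hz
    have hmap : Tendsto (fun w => w - z) (𝓝[≠] z) (𝓝[≠] 0) := by
      refine tendsto_nhdsWithin_iff.2 ⟨?_, ?_⟩
      · have : Continuous fun w : ℂ => w - z := by fun_prop
        simpa using (this.tendsto z).mono_left nhdsWithin_le_nhds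
      · filter_upwards [self_mem_nhdsWithin] with w hw
        exact sub_ne_zero.2 hw
    have he : ∀ w : ℂ, z • ContinuousLinearMap.id ℂ B - L +
        (w - z) • ContinuousLinearMap.id ℂ B = w • ContinuousLinearMap.id ℂ B - L := by
      intro w
      rw [sub_smul]
      abel
    refine ((hUF z hz).eventually_bijective_or (ContinuousLinearMap.id ℂ B)).imp ?_ ?_ <;>
    · intro h
      filter_upwards [hmap.eventually h] with w hw
      rwa [mem_resolventSet_iff_bijective, ← he w]
  obtain ⟨z₁, hz₁, hz₁L⟩ : ∃ z₁ ∈ U, ‖L‖ * ‖(1 : B →L[ℂ] B)‖ < ‖z₁‖ := by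
    by_contra! hcon
    exact hUb (isBounded_iff_forall_norm_le.2 ⟨_, hcon⟩)
  have hz₁' : ∀ᶠ w in 𝓝 z₁, w ∈ resolventSet ℂ L :=
    (spectrum.isOpen_resolventSet L).mem_nhds (spectrum.mem_resolventSet_of_norm_lt_mul hz₁L)
  by_contra hzc
  have hz' := (hdich z hz).resolve_left hzc
  obtain ⟨w, -, hw1, hw2⟩ := hU _ _
    (isOpen_setOf_eventually_punctured (· ∈ resolventSet ℂ L))
    (isOpen_setOf_eventually_punctured (· ∉ resolventSet ℂ L)) hdich
    ⟨z₁, hz₁, hz₁'.filter_mono nhdsWithin_le_nhds⟩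
    ⟨z, hz, hz'⟩
  obtain ⟨v, hv1, hv2⟩ := (Filter.Eventually.and
    (show ∀ᶠ w in 𝓝[≠] w, w ∈ resolventSet ℂ L from hw1)
    (show ∀ᶠ w in 𝓝[≠] w, w ∉ resolventSet ℂ L from hw2)).exists
  exact hv2 hv1

/-- On a connected unbounded set of points `z` for which `z - L` is Fredholm, the resolvent
preserves the closed invariant subspaces. -/
theorem eventually_resolvent_apply_mem [CompleteSpace B] {L : B →L[ℂ] B} {U : Set ℂ}
    (hU : IsPreconnected U) (hUF : ∀ z ∈ U, (z • ContinuousLinearMap.id ℂ B - L).IsFredholm)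
    (hUb : ¬ Bornology.IsBounded U) {E : Submodule ℂ B} (hE : IsClosed (E : Set B))
    (hLE : ∀ x ∈ E, L x ∈ E) {x : B} (hx : x ∈ E) {z : ℂ} (hz : z ∈ U) :
    ∀ᶠ w in 𝓝[≠] z, resolvent L w x ∈ E := by
  obtain ⟨z₁, hz₁, hz₁L⟩ : ∃ z₁ ∈ U, ‖L‖ < ‖z₁‖ := by
    by_contra! hcon
    exact hUb (isBounded_iff_forall_norm_le.2 ⟨_, hcon⟩)
  have hUS : ∀ z ∈ U, ∀ᶠ w in 𝓝[≠] z, w ∈ resolventSet ℂ L := fun z hz =>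
    eventually_mem_resolventSet hU hUF hUb hz
  -- the identity theorem is applied to the resolvent modulo `E`
  have : IsClosed (E : Set B) := hE
  have h1 : ∀ᶠ w in 𝓝[≠] z₁, (fun w => E.mkQL (resolvent L w x)) =ᶠ[𝓝 w] 0 := by
    have hopen : IsOpen {w : ℂ | w ∈ resolventSet ℂ L ∧ ‖L‖ < ‖w‖} :=
      (spectrum.isOpen_resolventSet L).inter (isOpen_lt continuous_const continuous_norm)
    have hlt : ∀ᶠ w in 𝓝[≠] z₁, ‖L‖ < ‖w‖ := mem_nhdsWithin_of_mem_nhds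
      ((isOpen_lt continuous_const continuous_norm).mem_nhds hz₁L)
    filter_upwards [hUS z₁ hz₁, hlt] with w hw hwL
    filter_upwards [hopen.mem_nhds ⟨hw, hwL⟩] with v hv
    exact (Submodule.Quotient.mk_eq_zero E).2 (resolvent_apply_mem hE hLE hv.1 hv.2 hx)
  have h2 := hU.eventually_eq_zero_of_frequently (spectrum.isOpen_resolventSet L)
    (differentiableOn_resolvent_apply L x E.mkQL) hUS hz₁ h1.frequently hz
  filter_upwards [h2] with w hw
  exact (Submodule.Quotient.mk_eq_zero E).1 hw

/-- Bounded functionals `ψ k` with `ψ (k + 1) ∘ L = β k • ψ k` on an invariant subspace, where the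
products of the `β k` grow at rate at least `Λ`, force every vector `x₀` killed by
`ψ 1, ψ 2, …` to satisfy `ψ 0 (L ^ n x₀) = 0` for all `n`, unless the filled essential
spectrum contains the disc of radius `Λ`.

If `z • g = x₀ + L g` with `‖z‖ < Λ` then `z * ψ (k + 1) g = β k * ψ k g`, so that `ψ 0 g = 0` since
otherwise `ψ k g` would be unbounded in `k`.  Thus `ψ 0` kills the resolvent at `x₀` near some point
of the disc; by analytic continuation it does so arbitrarily far out, where the resolvent at `x₀`
has the asymptotic expansion `∑ z ^ (-n - 1) • L ^ n x₀`. -/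
theorem apply_pow_eq_zero_of_notMem_filledEssSpectrum [CompleteSpace B] {L : B →L[ℂ] B}
    {E₀ : Submodule ℂ B} (hLE₀ : ∀ x ∈ E₀, L x ∈ E₀) {ψ : ℕ → B →L[ℂ] ℂ} {M : ℝ}
    (hM : ∀ k, ‖ψ k‖ ≤ M) {β : ℕ → ℂ}
    (hψ : ∀ k, ∀ x ∈ E₀, ψ (k + 1) (L x) = β k * ψ k x) (hβ : ∀ k, β k ≠ 0) {Λ : ℝ} (hΛ : 0 < Λ)
    (hβΛ : ∀ r, 0 ≤ r → r < Λ →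
      Tendsto (fun m : ℕ => r ^ m / ∏ j ∈ Finset.range m, ‖β j‖) atTop (𝓝 0))
    {x₀ : B} (hx₀ : x₀ ∈ E₀) (hx₀ψ : ∀ k, ψ (k + 1) x₀ = 0) {z₀ : ℂ} (hz₀ : ‖z₀‖ ≤ Λ)
    (hz₀' : z₀ ∉ filledEssSpectrum L) (n : ℕ) : ψ 0 ((L ^ n) x₀) = 0 := by
  simp only [filledEssSpectrum, mem_union, mem_ofPred_eq, not_or, not_and] at hz₀'
  obtain ⟨hz₀F, hz₀b⟩ := hz₀'
  set U := connectedComponentIn (essSpectrum L)ᶜ z₀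
  have hUb : ¬ Bornology.IsBounded U := hz₀b hz₀F
  have hU : IsPreconnected U := isPreconnected_connectedComponentIn
  have hz₀U : z₀ ∈ U := mem_connectedComponentIn hz₀F
  have hUF : ∀ z ∈ U, (z • ContinuousLinearMap.id ℂ B - L).IsFredholm := by
    intro z hz
    have := connectedComponentIn_subset _ _ hz
    simpa [essSpectrum] using this
  have hUS : ∀ z ∈ U, ∀ᶠ w in 𝓝[≠] z, w ∈ resolventSet ℂ L := fun z hz =>
    eventually_mem_resolventSet hU hUF hUb hz
  set E := E₀.topologicalClosure
  have hE : IsClosed (E : Set B) := E₀.isClosed_topologicalClosure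
  have hE₀E : E₀ ≤ E := E₀.le_topologicalClosure
  have hLE : ∀ x ∈ E, L x ∈ E := fun x hx =>
    map_mem_closure L.continuous hx hLE₀
  have hψE : ∀ k, ∀ x ∈ E, ψ (k + 1) (L x) = β k * ψ k x := by
    intro k
    exact fun x hx => closure_minimal (s := (E₀ : Set B)) (hψ k)
      (isClosed_eq (by fun_prop) (by fun_prop)) hx
  -- within the disc, the relation between the functionals forces `ψ 0` to vanish on the resolvent
  have hdisc : ∀ w ∈ resolventSet ℂ L, ‖w‖ < Λ → resolvent L w x₀ ∈ E →
      ψ 0 (resolvent L w x₀) = 0 := by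
    intro w hw hwΛ hwE
    set g := resolvent L w x₀
    have hg : w • g = x₀ + L g := smul_resolvent_apply L hw x₀
    have hstep : ∀ k, w * ψ (k + 1) g = β k * ψ k g := by
      intro k
      rw [← hψE k g hwE, ← smul_eq_mul, ← map_smul, hg, map_add, hx₀ψ, zero_add]
    have hiter : ∀ m : ℕ, w ^ m * ψ m g = (∏ j ∈ Finset.range m, β j) * ψ 0 g := by
      intro m
      induction m with
      | zero => simp
      | succ m ih =>
        rw [pow_succ, mul_assoc, hstep, mul_left_comm, ih, Finset.prod_range_succ]
        ring
    have hbound : ∀ m : ℕ, ‖ψ 0 g‖ ≤ ‖w‖ ^ m / (∏ j ∈ Finset.range m, ‖β j‖) * (M * ‖g‖) := by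
      intro m
      have hpos : 0 < ∏ j ∈ Finset.range m, ‖β j‖ :=
        Finset.prod_pos fun j _ => norm_pos_iff.2 (hβ j)
      rw [div_mul_eq_mul_div, le_div_iff₀ hpos]
      calc ‖ψ 0 g‖ * ∏ j ∈ Finset.range m, ‖β j‖ = ‖w ^ m * ψ m g‖ := by
            rw [hiter, norm_mul, norm_prod, mul_comm]
        _ ≤ ‖w‖ ^ m * (M * ‖g‖) := by
            rw [norm_mul, norm_pow]
            gcongr
            exact (ψ m).le_of_opNorm_le (hM m) g
    have hlim := (hβΛ ‖w‖ (norm_nonneg _) hwΛ).mul_const (M * ‖g‖)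
    rw [zero_mul] at hlim
    exact norm_le_zero_iff.1 (ge_of_tendsto' hlim hbound)
  have hfreq : ∃ᶠ w in 𝓝[≠] z₀, (fun w => ψ 0 (resolvent L w x₀)) =ᶠ[𝓝 w] 0 := by
    have h1 := eventually_eventually_nhdsWithin.2 ((hUS z₀ hz₀U).and
      (eventually_resolvent_apply_mem hU hUF hUb hE hLE (hE₀E hx₀) hz₀U))
    -- `z₀` may lie on the boundary circle of the disc
    have h2 : ∃ᶠ w in 𝓝[≠] z₀, ‖w‖ < Λ := by
      rcases eq_or_ne z₀ 0 with rfl | hne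
      · have h3 : ∀ᶠ w in 𝓝[≠] (0 : ℂ), ‖w‖ < Λ := mem_nhdsWithin_of_mem_nhds
          ((isOpen_lt continuous_norm continuous_const).mem_nhds (by simpa using hΛ))
        exact h3.frequently
      · have ht : Tendsto (fun t : ℝ => (t : ℂ) * z₀) (𝓝[<] 1) (𝓝[≠] z₀) := by
          refine tendsto_nhdsWithin_iff.2 ⟨?_, ?_⟩
          · have : Continuous fun t : ℝ => (t : ℂ) * z₀ := by fun_prop
            simpa using (this.tendsto 1).mono_left nhdsWithin_le_nhds
          · filter_upwards [self_mem_nhdsWithin] with t ht h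
            have h : (t : ℂ) * z₀ = z₀ := h
            have : (t : ℂ) = 1 := by simpa [hne] using h
            exact ht.ne (by exact_mod_cast this)
        refine ht.frequently (Eventually.frequently ?_)
        filter_upwards [Ioo_mem_nhdsLT (zero_lt_one' ℝ)] with t ht
        rw [norm_mul, Complex.norm_real, Real.norm_of_nonneg ht.1.le]
        calc t * ‖z₀‖ < 1 * ‖z₀‖ := by
              gcongr
              exact ht.2
          _ ≤ Λ := by rwa [one_mul]
    refine (h2.and_eventually (h1.and self_mem_nhdsWithin)).mono ?_
    rintro w ⟨hwΛ, hw, hwz⟩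
    rw [isOpen_compl_singleton.nhdsWithin_eq hwz] at hw
    filter_upwards [hw, (isOpen_lt continuous_norm continuous_const).mem_nhds hwΛ] with v hv hvΛ
    exact hdisc v hv.1 hvΛ hv.2
  have hzero : ∀ z ∈ U, ∀ᶠ w in 𝓝[≠] z, ψ 0 (resolvent L w x₀) = 0 := fun z hz =>
    hU.eventually_eq_zero_of_frequently (spectrum.isOpen_resolventSet L)
      (differentiableOn_resolvent_apply L x₀ (ψ 0)) hUS hz₀U hfreq hz
  have hfar : ∀ k : ℕ, ∃ w ∈ resolventSet ℂ L, (k : ℝ) < ‖w‖ ∧ ψ 0 (resolvent L w x₀) = 0 := by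
    intro k
    obtain ⟨z, hz, hzk⟩ : ∃ z ∈ U, (k : ℝ) < ‖z‖ := by
      by_contra! hcon
      exact hUb (isBounded_iff_forall_norm_le.2 ⟨_, hcon⟩)
    have h1 : ∀ᶠ w in 𝓝[≠] z, (k : ℝ) < ‖w‖ := mem_nhdsWithin_of_mem_nhds
      ((isOpen_lt continuous_const continuous_norm).mem_nhds hzk)
    obtain ⟨w, hw1, hw2, hw3⟩ := ((hUS z hz).and (h1.and (hzero z hz))).exists
    exact ⟨w, hw1, hw2, hw3⟩
  choose w hwS hwk hw0 using hfar
  have hres : Tendsto (fun k => resolvent L (w k)) atTop (𝓝 0) := by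
    refine (spectrum.resolvent_tendsto_cobounded L).comp ?_
    rw [← tendsto_norm_atTop_iff_cobounded]
    exact tendsto_atTop_mono (fun k => (hwk k).le) tendsto_natCast_atTop_atTop
  have hlim : ∀ x, Tendsto (fun k => ψ 0 (resolvent L (w k) x)) atTop (𝓝 0) := by
    intro x
    have h1 : Continuous fun A : B →L[ℂ] B => ψ 0 (A x) := by fun_prop
    simpa [Function.comp_def] using (h1.tendsto 0).comp hres
  -- the coefficients of the expansion at infinity vanish one after the other
  suffices h : ∀ n k, ψ 0 (resolvent L (w k) ((L ^ n) x₀)) = 0 by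
    have h1 : ∀ k, ψ 0 ((L ^ n) x₀) = - ψ 0 (resolvent L (w k) ((L ^ (n + 1)) x₀)) := by
      intro k
      have h2 := congrArg (ψ 0) (smul_resolvent_apply' L (hwS k) ((L ^ n) x₀))
      rw [map_smul, h, smul_zero, map_add] at h2
      rw [pow_succ', mul_apply_eq_comp]
      exact eq_neg_of_add_eq_zero_left h2.symm
    rw [h1 0, h, neg_zero]
  intro n
  induction n with
  | zero => simpa using hw0
  | succ n ih =>
    have h1 : ∀ k, ψ 0 (resolvent L (w k) ((L ^ (n + 1)) x₀)) = - ψ 0 ((L ^ n) x₀) := by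
      intro k
      have h2 := congrArg (ψ 0) (smul_resolvent_apply' L (hwS k) ((L ^ n) x₀))
      rw [map_smul, ih, smul_zero, map_add] at h2
      rw [pow_succ', mul_apply_eq_comp]
      exact eq_neg_of_add_eq_zero_right h2.symm
    have h2 : - ψ 0 ((L ^ n) x₀) = 0 := by
      refine tendsto_nhds_unique ?_ (hlim ((L ^ (n + 1)) x₀))
      simp only [h1]
      exact tendsto_const_nhds
    intro k
    rw [h1, h2]

/-- A point of the filled essential spectrum can be moved away from the origin, along a ray, into
the essential spectrum: a component of the complement that contains the whole ray is unbounded. -/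
theorem enorm_le_essSpectralRadius {L : B →L[ℂ] B} {z : ℂ} (hz : z ∈ filledEssSpectrum L) :
    ‖z‖ₑ ≤ essSpectralRadius L := by
  have key : ∀ t : ℝ, 1 ≤ t → (t : ℂ) * z ∈ essSpectrum L → ‖z‖ₑ ≤ essSpectralRadius L := by
    intro t ht h
    refine le_trans ?_ (le_iSup₂ (f := fun z (_ : z ∈ essSpectrum L) => ‖z‖ₑ) _ h)
    rw [enorm_le_iff_norm_le, norm_mul, Complex.norm_real]
    exact le_mul_of_one_le_left (norm_nonneg _) (ht.trans (Real.le_norm_self t))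
  rcases hz with hz | ⟨hz, hzb⟩
  · exact key 1 le_rfl (by simpa using hz)
  · by_contra hcon
    have hray : ∀ t : ℝ, 1 ≤ t → (t : ℂ) * z ∉ essSpectrum L := fun t ht h => hcon (key t ht h)
    have hz0 : z ≠ 0 := by
      rintro rfl
      simp at hcon
    have hconn : IsPreconnected ((fun t : ℝ => (t : ℂ) * z) '' Ici 1) :=
      isPreconnected_Ici.image _ (by fun_prop)
    have hsub := hconn.subset_connectedComponentIn (x := z) (F := (essSpectrum L)ᶜ)
      ⟨1, self_mem_Ici, by simp⟩ (by rintro _ ⟨t, ht, rfl⟩; exact hray t ht)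
    obtain ⟨R, hR⟩ := isBounded_iff_forall_norm_le.1 (hzb.subset hsub)
    have hzp : 0 < ‖z‖ := norm_pos_iff.2 hz0
    have h1 := hR _ (mem_image_of_mem _ (mem_Ici.2 (le_max_left 1 ((R + 1) / ‖z‖))))
    rw [norm_mul, Complex.norm_real] at h1
    have h2 : (R + 1) / ‖z‖ * ‖z‖ ≤ ‖max 1 ((R + 1) / ‖z‖)‖ * ‖z‖ := by
      gcongr
      exact (le_max_right _ _).trans (Real.le_norm_self _)
    rw [div_mul_cancel₀ _ hzp.ne'] at h2
    linarith

end Resolvent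

/-! ### One-sided neighbourhood filters -/

/-- A one-sided point of `[0,1]`, encoded as its punctured one-sided neighbourhood filter. -/
def IsGerm (F : Filter unitInterval) : Prop :=
  F.NeBot ∧ ∃ x, F = 𝓝[>] x ∨ F = 𝓝[<] x

/-- Distinct one-sided points are separated by their filters. -/
theorem IsGerm.eq_of_le_of_le {F G H : Filter unitInterval} (hF : IsGerm F) (hG : IsGerm G) [H.NeBot]
    (hHF : H ≤ F) (hHG : H ≤ G) : F = G := by
  obtain ⟨-, x, hx⟩ := hF
  obtain ⟨-, y, hy⟩ := hG
  have hFx : F ≤ 𝓝 x := by rcases hx with rfl | rfl <;> exact nhdsWithin_le_nhds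
  have hGy : G ≤ 𝓝 y := by rcases hy with rfl | rfl <;> exact nhdsWithin_le_nhds
  obtain rfl : x = y :=
    eq_of_nhds_neBot (neBot_of_le (le_inf (hHF.trans hFx) (hHG.trans hGy)))
  have hlr : ¬ ∃ t : unitInterval, t ∈ Ioi x ∧ t ∈ Iio x := fun ⟨t, h1, h2⟩ =>
    lt_asymm (mem_Ioi.1 h1) (mem_Iio.1 h2)
  rcases hx with rfl | rfl <;> rcases hy with rfl | rfl
  · rfl
  · exact absurd (Filter.nonempty_of_mem
      (inter_mem (hHF self_mem_nhdsWithin) (hHG self_mem_nhdsWithin))) hlr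
  · exact absurd (Filter.nonempty_of_mem
      (inter_mem (hHG self_mem_nhdsWithin) (hHF self_mem_nhdsWithin))) hlr
  · rfl

/-- An interval that meets every neighbourhood of a one-sided point is itself a neighbourhood. -/
theorem IsGerm.mem_of_frequently {F : Filter unitInterval} (hF : IsGerm F) {S : Set unitInterval}
    (hS : S.OrdConnected) (h : ∃ᶠ t in F, t ∈ S) : S ∈ F := by
  obtain ⟨hn, x, rfl | rfl⟩ := hF
  · obtain ⟨s, hs, hxs⟩ := (h.and_eventually self_mem_nhdsWithin).exists
    filter_upwards [Ioo_mem_nhdsGT hxs] with t ht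
    obtain ⟨s', hs', hxs'⟩ := (h.and_eventually (Ioo_mem_nhdsGT ht.1)).exists
    exact hS.out hs' hs ⟨hxs'.2.le, ht.2.le⟩
  · obtain ⟨s, hs, hxs⟩ := (h.and_eventually self_mem_nhdsWithin).exists
    filter_upwards [Ioo_mem_nhdsLT hxs] with t ht
    obtain ⟨s', hs', hxs'⟩ := (h.and_eventually (Ioo_mem_nhdsLT ht.2)).exists
    exact hS.out hs hs' ⟨ht.1.le, hxs'.1.le⟩

theorem IsGerm.mem_or_compl_mem {F : Filter unitInterval} (hF : IsGerm F) {S : Set unitInterval}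
    (hS : S.OrdConnected) : S ∈ F ∨ Sᶜ ∈ F := by
  by_cases h : ∃ᶠ t in F, t ∈ S
  · exact Or.inl (hF.mem_of_frequently hS h)
  · exact Or.inr (not_frequently.1 h)

/-- A strictly monotone function has a one-sided limit, and approaches it from one side. -/
theorem IsGerm.exists_tendsto {F : Filter unitInterval} (hF : IsGerm F) {S : Set unitInterval}
    (hS : S ∈ F) {f : unitInterval → unitInterval} (hf : StrictMonoOn f S ∨ StrictAntiOn f S) :
    ∃ G, IsGerm G ∧ Tendsto f F G := by
  obtain ⟨hn, x, rfl | rfl⟩ := hF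
  · obtain ⟨b, hb, hbS⟩ :=
      (mem_nhdsGT_iff_exists_Ioo_subset' (lt_one_of_nhdsGT_neBot hn)).1 hS
    obtain ⟨y, hy | hy⟩ := tendsto_step_gt hb (hf.imp (·.mono hbS) (·.mono hbS))
    · exact ⟨_, ⟨hy.neBot, y, Or.inl rfl⟩, hy⟩
    · exact ⟨_, ⟨hy.neBot, y, Or.inr rfl⟩, hy⟩
  · obtain ⟨b, hb, hbS⟩ :=
      (mem_nhdsLT_iff_exists_Ioo_subset' (pos_of_nhdsLT_neBot hn)).1 hS
    obtain ⟨y, hy | hy⟩ := tendsto_step_lt hb (hf.imp (·.mono hbS) (·.mono hbS))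
    · exact ⟨_, ⟨hy.neBot, y, Or.inl rfl⟩, hy⟩
    · exact ⟨_, ⟨hy.neBot, y, Or.inr rfl⟩, hy⟩

/-! ### Branches and their inverses -/

section Partition

variable {T : unitInterval → unitInterval} {N : ℕ} {c : Fin (N + 1) → unitInterval}

theorem isOpen_branch (l : Fin N) : IsOpen (branch c l) := isOpen_Ioo

theorem IsMonotonePartition.eq_of_mem_branch (h : IsMonotonePartition T c) {i j : Fin N}
    {x : unitInterval} (hi : x ∈ branch c i) (hj : x ∈ branch c j) : i = j := by
  have key : ∀ {i j : Fin N}, x ∈ branch c i → x ∈ branch c j → ¬ i < j := by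
    intro i j hi hj hij
    have h1 : c i.succ ≤ c j.castSucc :=
      h.strictMono.monotone (Fin.succ_le_castSucc_iff.2 hij)
    exact absurd (hj.1.trans hi.2) (not_lt.2 h1)
  exact le_antisymm (not_lt.1 (key hj hi)) (not_lt.1 (key hi hj))

theorem IsMonotonePartition.exists_branch_mem (h : IsMonotonePartition T c)
    {F : Filter unitInterval} (hF : IsGerm F) : ∃ j, branch c j ∈ F := by
  obtain ⟨hn, x, rfl | rfl⟩ := hF
  · obtain ⟨j, -, b, hb, hsub⟩ := exists_branch_gt h (lt_one_of_nhdsGT_neBot hn)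
    exact ⟨j, mem_of_superset (Ioo_mem_nhdsGT hb) hsub⟩
  · obtain ⟨j, -, b, hb, hsub⟩ := exists_branch_lt h (pos_of_nhdsLT_neBot hn)
    exact ⟨j, mem_of_superset (Ioo_mem_nhdsLT hb) hsub⟩

theorem IsMonotonePartition.exists_mem_branch_or_mem_frontier (h : IsMonotonePartition T c)
    (x : unitInterval) : ∃ j, x ∈ branch c j ∨ x ∈ frontier (branch c j) := by
  obtain ⟨j, hj⟩ : ∃ j, x ∈ closure (branch c j) := by
    rcases lt_or_ge x 1 with hx | hx
    · obtain ⟨j, hj, -⟩ := exists_branch_gt h hx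
      exact ⟨j, hj⟩
    · obtain ⟨j, hj, -⟩ := exists_branch_lt h (zero_lt_one.trans_le hx)
      exact ⟨j, hj⟩
  refine ⟨j, or_iff_not_imp_left.2 fun hx => ?_⟩
  rw [(isOpen_branch j).frontier_eq]
  exact ⟨hj, hx⟩

theorem IsMonotonePartition.exists_tendsto (h : IsMonotonePartition T c) {F : Filter unitInterval}
    (hF : IsGerm F) : ∃ G, IsGerm G ∧ Tendsto T F G := by
  obtain ⟨j, hj⟩ := h.exists_branch_mem hF
  exact hF.exists_tendsto hj (h.monotoneOn j)

theorem IsMonotonePartition.injOn (h : IsMonotonePartition T c) (l : Fin N) :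
    InjOn T (branch c l) :=
  (h.monotoneOn l).elim (·.injOn) (·.injOn)

theorem IsMonotonePartition.invFunOn_apply (h : IsMonotonePartition T c) {l : Fin N}
    {x : unitInterval} (hx : x ∈ branch c l) : Function.invFunOn T (branch c l) (T x) = x :=
  (h.injOn l).leftInvOn_invFunOn hx

theorem IsMonotonePartition.ordConnected_image (h : IsMonotonePartition T c) (l : Fin N) :
    (T '' branch c l).OrdConnected :=
  (isPreconnected_Ioo.image T (h.continuousOn l)).ordConnected

theorem IsMonotonePartition.continuousAt (h : IsMonotonePartition T c) {l : Fin N}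
    {x : unitInterval} (hx : x ∈ branch c l) : ContinuousAt T x :=
  (h.continuousOn l).continuousAt ((isOpen_branch l).mem_nhds hx)

theorem IsMonotonePartition.invFunOn_strictMonoOn (h : IsMonotonePartition T c) (l : Fin N) :
    StrictMonoOn T (branch c l) ∧
        StrictMonoOn (Function.invFunOn T (branch c l)) (T '' branch c l) ∨
      StrictAntiOn T (branch c l) ∧
        StrictAntiOn (Function.invFunOn T (branch c l)) (T '' branch c l) := by
  rcases h.monotoneOn l with hm | hm
  · refine Or.inl ⟨hm, ?_⟩
    rintro _ ⟨x, hx, rfl⟩ _ ⟨y, hy, rfl⟩ hxy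
    rw [h.invFunOn_apply hx, h.invFunOn_apply hy]
    exact (hm.lt_iff_lt hx hy).1 hxy
  · refine Or.inr ⟨hm, ?_⟩
    rintro _ ⟨x, hx, rfl⟩ _ ⟨y, hy, rfl⟩ hxy
    rw [h.invFunOn_apply hx, h.invFunOn_apply hy]
    exact (hm.lt_iff_gt hx hy).1 hxy

theorem invFunOn_mem_branch {l : Fin N} {x : unitInterval} (hx : x ∈ T '' branch c l) :
    Function.invFunOn T (branch c l) x ∈ branch c l :=
  Function.invFunOn_mem hx

theorem apply_invFunOn_branch {l : Fin N} {x : unitInterval} (hx : x ∈ T '' branch c l) :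
    T (Function.invFunOn T (branch c l) x) = x :=
  Function.invFunOn_eq hx

theorem IsMonotonePartition.exists_tendsto_invFunOn (h : IsMonotonePartition T c) {l : Fin N}
    {G : Filter unitInterval} (hG : IsGerm G) (hl : T '' branch c l ∈ G) :
    ∃ F, IsGerm F ∧ Tendsto (Function.invFunOn T (branch c l)) G F :=
  hG.exists_tendsto hl ((h.invFunOn_strictMonoOn l).imp (·.2) (·.2))

theorem tendsto_comp_invFunOn {l : Fin N} {G : Filter unitInterval} (hl : T '' branch c l ∈ G) :
    Tendsto (fun x => T (Function.invFunOn T (branch c l) x)) G G := by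
  refine tendsto_id.congr' ?_
  filter_upwards [hl] with x hx using (apply_invFunOn_branch hx).symm

theorem IsMonotonePartition.image_branch_mem_nhds (h : IsMonotonePartition T c) {l : Fin N}
    {y : unitInterval} (hy : y ∈ branch c l) : T '' branch c l ∈ 𝓝 (T y) := by
  obtain ⟨u, hu⟩ := exists_between hy.1
  obtain ⟨v, hv⟩ := exists_between hy.2
  have hu' : u ∈ branch c l := ⟨hu.1, hu.2.trans hy.2⟩
  have hv' : v ∈ branch c l := ⟨hy.1.trans hv.1, hv.2⟩
  have hoc := h.ordConnected_image l
  rcases h.monotoneOn l with hm | hm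
  · exact mem_of_superset (Ioo_mem_nhds (hm hu' hy hu.2) (hm hy hv' hv.1))
      (Ioo_subset_Icc_self.trans (hoc.out (mem_image_of_mem T hu') (mem_image_of_mem T hv')))
  · exact mem_of_superset (Ioo_mem_nhds (hm hy hv' hv.1) (hm hu' hy hu.2))
      (Ioo_subset_Icc_self.trans (hoc.out (mem_image_of_mem T hv') (mem_image_of_mem T hu')))

theorem IsMonotonePartition.continuousAt_invFunOn (h : IsMonotonePartition T c) {l : Fin N}
    {y : unitInterval} (hy : y ∈ branch c l) :
    ContinuousAt (Function.invFunOn T (branch c l)) (T y) := by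
  have hS := h.image_branch_mem_nhds hy
  have him : Function.invFunOn T (branch c l) '' (T '' branch c l) = branch c l := by
    rw [image_image]
    exact (image_congr fun x hx => h.invFunOn_apply hx).trans (image_id' _)
  have hb : branch c l ∈ 𝓝 (Function.invFunOn T (branch c l) (T y)) := by
    rw [h.invFunOn_apply hy]
    exact (isOpen_branch l).mem_nhds hy
  rcases h.invFunOn_strictMonoOn l with ⟨-, hm⟩ | ⟨-, hm⟩
  · exact hm.continuousAt_of_image_mem_nhds hS (by rwa [him])
  · -- a decreasing function is an increasing one into the order dual
    have hm' : StrictMonoOn (OrderDual.toDual ∘ Function.invFunOn T (branch c l))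
        (T '' branch c l) := hm.dual_right
    exact hm'.continuousAt_of_image_mem_nhds hS (by
      rw [image_comp, him, Equiv.image_eq_preimage_symm]
      exact hb)

theorem boundaryOrbit_zero (h : IsMonotonePartition T c) {l : Fin N} {a : unitInterval}
    (ha : a ∈ frontier (branch c l)) : boundaryOrbit T c l a 0 = a := by
  have hF : (𝓝[branch c l] a).NeBot := mem_closure_iff_nhdsWithin_neBot.1 ha.1
  exact tendsto_nhds_unique (tendsto_boundaryOrbit h ha 0)
    (tendsto_id.mono_left nhdsWithin_le_nhds)

theorem boundaryOrbit_succ (h : IsMonotonePartition T c) {l j : Fin N} {a : unitInterval}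
    (ha : a ∈ frontier (branch c l)) {k : ℕ} (hk : boundaryOrbit T c l a k ∈ branch c j) :
    boundaryOrbit T c l a (k + 1) = T (boundaryOrbit T c l a k) := by
  have hF : (𝓝[branch c l] a).NeBot := mem_closure_iff_nhdsWithin_neBot.1 ha.1
  refine tendsto_nhds_unique (tendsto_boundaryOrbit h ha (k + 1)) ?_
  rw [Function.iterate_succ']
  exact (h.continuousAt hk).tendsto.comp (tendsto_boundaryOrbit h ha k)

/-- A point `x` that is not a boundary value of the branch `T|_{ω_l}` is either an exterior point
of `T ω_l`, or the image of a point of `ω_l`. -/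
theorem IsMonotonePartition.compl_image_mem_or_exists (h : IsMonotonePartition T c) {l : Fin N}
    {x : unitInterval} (hx : ∀ b ∈ frontier (branch c l), x ≠ boundaryOrbit T c l b 1) :
    (T '' branch c l)ᶜ ∈ 𝓝[≠] x ∨ ∃ y ∈ branch c l, T y = x := by
  refine or_iff_not_imp_left.2 fun hnot => ?_
  obtain ⟨G, hG, hGx, hGS⟩ : ∃ G, IsGerm G ∧ G ≤ 𝓝 x ∧ T '' branch c l ∈ G := by
    by_contra! hcon
    apply hnot
    have key : ∀ G, (G = 𝓝[<] x ∨ G = 𝓝[>] x) → (T '' branch c l)ᶜ ∈ G := by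
      intro G hG
      have hle : G ≤ 𝓝 x := by rcases hG with rfl | rfl <;> exact nhdsWithin_le_nhds
      rcases G.eq_or_neBot with hb | hb
      · rw [hb]
        exact mem_bot
      · have hG' : IsGerm G := ⟨hb, x, hG.symm⟩
        exact (hG'.mem_or_compl_mem (h.ordConnected_image l)).resolve_left (hcon G hG' hle)
    rw [← Iio_union_Ioi, nhdsWithin_union, mem_sup]
    exact ⟨key _ (Or.inl rfl), key _ (Or.inr rfl)⟩
  have := hG.1
  obtain ⟨F, hF, hgF⟩ := h.exists_tendsto_invFunOn hG hGS
  obtain ⟨y, hFy⟩ : ∃ y, F ≤ 𝓝 y := by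
    obtain ⟨-, y, rfl | rfl⟩ := hF <;> exact ⟨y, nhdsWithin_le_nhds⟩
  have hgy : Tendsto (Function.invFunOn T (branch c l)) G (𝓝[branch c l] y) := by
    refine tendsto_nhdsWithin_iff.2 ⟨hgF.mono_right hFy, ?_⟩
    filter_upwards [hGS] with t ht using invFunOn_mem_branch ht
  have hTx : Tendsto (T ∘ Function.invFunOn T (branch c l)) G (𝓝 x) :=
    (tendsto_comp_invFunOn hGS).mono_right hGx
  -- the inverse branch tends to some `y` along `G`; an end point `y` of `ω_l` is excluded by `hx`
  by_cases hy : y ∈ branch c l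
  · exact ⟨y, hy, tendsto_nhds_unique ((h.continuousAt hy).tendsto.comp
      (hgy.mono_right nhdsWithin_le_nhds)) hTx⟩
  · have hyf : y ∈ frontier (branch c l) := by
      rw [(isOpen_branch l).frontier_eq]
      exact ⟨mem_closure_iff_nhdsWithin_neBot.2 hgy.neBot, hy⟩
    exact absurd (tendsto_nhds_unique hTx ((tendsto_boundaryOrbit h hyf 1).comp hgy)) (hx y hyf)

end Partition

/-! ### Jumps of functions with one-sided limits -/

/-- The function `h` has one-sided limits at `x`, and the right limit minus the left limit is `d`.
At an end point of `[0,1]` one of the two filters is trivial, so that `d` is arbitrary there. -/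
def HasJump (h : unitInterval → ℂ) (x : unitInterval) (d : ℂ) : Prop :=
  ∃ u v, Tendsto h (𝓝[>] x) (𝓝 u) ∧ Tendsto h (𝓝[<] x) (𝓝 v) ∧ d = u - v

theorem HasJump.add {h₁ h₂ : unitInterval → ℂ} {x : unitInterval} {d₁ d₂ : ℂ}
    (H₁ : HasJump h₁ x d₁) (H₂ : HasJump h₂ x d₂) : HasJump (h₁ + h₂) x (d₁ + d₂) := by
  obtain ⟨u₁, v₁, hu₁, hv₁, rfl⟩ := H₁
  obtain ⟨u₂, v₂, hu₂, hv₂, rfl⟩ := H₂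
  exact ⟨_, _, hu₁.add hu₂, hv₁.add hv₂, by ring⟩

theorem HasJump.const_smul {h : unitInterval → ℂ} {x : unitInterval} {d : ℂ}
    (H : HasJump h x d) (r : ℂ) : HasJump (r • h) x (r * d) := by
  obtain ⟨u, v, hu, hv, rfl⟩ := H
  exact ⟨_, _, hu.const_smul r, hv.const_smul r, by simp only [smul_eq_mul]; ring⟩

theorem HasJump.congr {h₁ h₂ : unitInterval → ℂ} {x : unitInterval} {d : ℂ}
    (H : HasJump h₁ x d) (he : h₁ =ᶠ[𝓝[≠] x] h₂) : HasJump h₂ x d := by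
  obtain ⟨u, v, hu, hv, rfl⟩ := H
  exact ⟨u, v, hu.congr' (he.filter_mono (nhdsGT_le_nhdsNE x)),
    hv.congr' (he.filter_mono (nhdsLT_le_nhdsNE x)), rfl⟩

theorem hasJump_zero (x : unitInterval) : HasJump 0 x 0 :=
  ⟨0, 0, tendsto_const_nhds, tendsto_const_nhds, by simp⟩

theorem ContinuousAt.hasJump {h : unitInterval → ℂ} {x : unitInterval} (H : ContinuousAt h x) :
    HasJump h x 0 :=
  ⟨h x, h x, H.tendsto.mono_left nhdsWithin_le_nhds, H.tendsto.mono_left nhdsWithin_le_nhds,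
    by simp⟩

theorem HasJump.sum {ι : Type*} {s : Finset ι} {f : ι → unitInterval → ℂ} {d : ι → ℂ}
    {x : unitInterval} (H : ∀ i ∈ s, HasJump (f i) x (d i)) :
    HasJump (∑ i ∈ s, f i) x (∑ i ∈ s, d i) := by
  classical
  induction s using Finset.induction_on with
  | empty => simpa using hasJump_zero x
  | insert i s hi ih =>
    rw [Finset.sum_insert hi, Finset.sum_insert hi]
    exact (H i (Finset.mem_insert_self _ _)).add
      (ih fun j hj => H j (Finset.mem_insert_of_mem hj))

theorem HasJump.unique {h : unitInterval → ℂ} {x : unitInterval} (h0 : 0 < x) (h1 : x < 1)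
    {d₁ d₂ : ℂ} (H₁ : HasJump h x d₁) (H₂ : HasJump h x d₂) : d₁ = d₂ := by
  obtain ⟨u₁, v₁, hu₁, hv₁, rfl⟩ := H₁
  obtain ⟨u₂, v₂, hu₂, hv₂, rfl⟩ := H₂
  have := nhdsGT_neBot_of_exists_gt ⟨_, h1⟩
  have := nhdsLT_neBot_of_exists_lt ⟨_, h0⟩
  rw [tendsto_nhds_unique hu₁ hu₂, tendsto_nhds_unique hv₁ hv₂]

/-- A function with one-sided limits at every point. -/
def IsRegulated (h : unitInterval → ℂ) : Prop :=
  ∀ F, IsGerm F → ∃ v, Tendsto h F (𝓝 v)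

theorem IsRegulated.exists_hasJump {h : unitInterval → ℂ} (H : IsRegulated h) (x : unitInterval) :
    ∃ d, HasJump h x d := by
  have key : ∀ G, (G = 𝓝[>] x ∨ G = 𝓝[<] x) → ∃ v, Tendsto h G (𝓝 v) := by
    intro G hG
    rcases G.eq_or_neBot with hb | hb
    · exact ⟨0, by rw [hb]; exact tendsto_bot⟩
    · exact H G ⟨hb, x, hG⟩
  obtain ⟨u, hu⟩ := key _ (Or.inl rfl)
  obtain ⟨v, hv⟩ := key _ (Or.inr rfl)
  exact ⟨_, u, v, hu, hv, rfl⟩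

/-- The one-sided limits of a function are bounded by its essential supremum. -/
theorem enorm_le_eLpNorm_of_tendsto {h : unitInterval → ℂ} {F : Filter unitInterval}
    (hF : IsGerm F) {v : ℂ} (hv : Tendsto h F (𝓝 v)) : ‖v‖ₑ ≤ eLpNorm h ∞ volume := by
  have hae : ∀ᵐ t ∂(volume : Measure unitInterval), ‖h t‖ₑ ≤ eLpNorm h ∞ volume := by
    rw [eLpNorm_exponent_top]
    exact enorm_ae_le_eLpNormEssSup h _
  have hIoo : ∀ x y : unitInterval, x < y → (volume : Measure unitInterval) (Ioo x y) ≠ 0 := by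
    intro x y hxy
    rw [unitInterval.volume_Ioo]
    simpa using hxy
  have hfreq : ∃ᶠ t in F, ‖h t‖ₑ ≤ eLpNorm h ∞ volume := by
    have key : ∀ x y : unitInterval, x < y → ∃ t ∈ Ioo x y, ‖h t‖ₑ ≤ eLpNorm h ∞ volume := by
      intro x y hxy
      by_contra! hcon
      exact hIoo x y hxy (measure_mono_null (fun t ht => not_le.2 (hcon t ht)) (ae_iff.1 hae))
    rw [Filter.frequently_iff]
    intro U hU
    obtain ⟨hn, x, rfl | rfl⟩ := hF
    · obtain ⟨b, hb, hbU⟩ :=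
        (mem_nhdsGT_iff_exists_Ioo_subset' (lt_one_of_nhdsGT_neBot hn)).1 hU
      obtain ⟨t, ht, htU⟩ := key x b hb
      exact ⟨t, hbU ht, htU⟩
    · obtain ⟨b, hb, hbU⟩ :=
        (mem_nhdsLT_iff_exists_Ioo_subset' (pos_of_nhdsLT_neBot hn)).1 hU
      obtain ⟨t, ht, htU⟩ := key b x hb
      exact ⟨t, hbU ht, htU⟩
  exact le_of_tendsto_of_frequently (continuous_enorm.continuousAt.tendsto.comp hv) hfreq

theorem HasJump.enorm_le {h : unitInterval → ℂ} {x : unitInterval} (h0 : 0 < x) (h1 : x < 1)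
    {d : ℂ} (H : HasJump h x d) : ‖d‖ₑ ≤ 2 * eLpNorm h ∞ volume := by
  obtain ⟨u, v, hu, hv, rfl⟩ := H
  have hR := nhdsGT_neBot_of_exists_gt ⟨_, h1⟩
  have hL := nhdsLT_neBot_of_exists_lt ⟨_, h0⟩
  refine enorm_sub_le.trans ?_
  rw [two_mul]
  exact add_le_add (enorm_le_eLpNorm_of_tendsto ⟨hR, x, Or.inl rfl⟩ hu)
    (enorm_le_eLpNorm_of_tendsto ⟨hL, x, Or.inr rfl⟩ hv)

/-! ### The action of the transfer operator on one-sided limits and jumps -/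

section Transfer

variable {T : unitInterval → unitInterval} {N : ℕ} {c : Fin (N + 1) → unitInterval}
  {φ : unitInterval → ℂ}

/-- The contribution `(φ · h) ∘ (T|_{ω_l})⁻¹ · 𝟙_{T ω_l}` of one branch to the transfer
operator. -/
noncomputable def branchTransfer (T : unitInterval → unitInterval) {N : ℕ}
    (c : Fin (N + 1) → unitInterval) (φ : unitInterval → ℂ) (l : Fin N) (h : unitInterval → ℂ) :
    unitInterval → ℂ :=
  (T '' branch c l).indicator ((fun x => φ x * h x) ∘ Function.invFunOn T (branch c l))

theorem transfer_eq_sum (h : unitInterval → ℂ) :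
    transfer T c φ h = ∑ l, branchTransfer T c φ l h := rfl

theorem branchTransfer_eventuallyEq_zero {l : Fin N} {G : Filter unitInterval}
    (hG : (T '' branch c l)ᶜ ∈ G) (h : unitInterval → ℂ) : branchTransfer T c φ l h =ᶠ[G] 0 := by
  filter_upwards [hG] with x hx using indicator_of_notMem hx _

theorem tendsto_branchTransfer {l : Fin N} {F G : Filter unitInterval} (hG : T '' branch c l ∈ G)
    (hFG : Tendsto (Function.invFunOn T (branch c l)) G F) {p v : ℂ} (hp : Tendsto φ F (𝓝 p))
    {h : unitInterval → ℂ} (hv : Tendsto h F (𝓝 v)) :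
    Tendsto (branchTransfer T c φ l h) G (𝓝 (p * v)) := by
  refine ((hp.mul hv).comp hFG).congr' ?_
  filter_upwards [hG] with x hx using (indicator_of_mem hx _).symm

theorem IsPiecewiseContinuous.isRegulated (hc : IsMonotonePartition T c)
    (hφ : IsPiecewiseContinuous c φ) : IsRegulated φ := by
  intro F hF
  obtain ⟨j, hj⟩ := hc.exists_branch_mem hF
  obtain ⟨g, hg, he⟩ := hφ j
  obtain ⟨x, hFx⟩ : ∃ x, F ≤ 𝓝 x := by
    obtain ⟨-, x, rfl | rfl⟩ := hF <;> exact ⟨x, nhdsWithin_le_nhds⟩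
  have hFx' : F ≤ 𝓝[branch c j] x := le_inf hFx (le_principal_iff.2 hj)
  have := hF.1
  have hx : x ∈ closure (branch c j) := mem_closure_iff_nhdsWithin_neBot.2 (neBot_of_le hFx')
  refine ⟨g x, ((hg x hx).mono_left (hFx'.trans (nhdsWithin_mono _ subset_closure))).congr' ?_⟩
  filter_upwards [hj] with w hw using (he hw).symm

theorem IsPiecewiseContinuous.continuousAt (hφ : IsPiecewiseContinuous c φ) {l : Fin N}
    {x : unitInterval} (hx : x ∈ branch c l) : ContinuousAt φ x := by
  obtain ⟨g, hg, he⟩ := hφ l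
  have hm := (isOpen_branch l).mem_nhds hx
  exact ((hg.mono subset_closure).continuousAt hm).congr
    (he.symm.eventuallyEq_of_mem hm)

theorem isPiecewiseContinuous_of_mem_piecewiseSmooth {h : unitInterval → ℂ}
    (hh : h ∈ piecewiseSmooth c) : IsPiecewiseContinuous c h := by
  intro l
  obtain ⟨g, hg, he⟩ := hh l
  exact ⟨fun x => g x, (hg.continuous.comp continuous_subtype_val).continuousOn,
    fun x hx => he x hx⟩

theorem isRegulated_transfer (hc : IsMonotonePartition T c) (hφ : IsPiecewiseContinuous c φ)
    {h : unitInterval → ℂ} (hh : IsRegulated h) : IsRegulated (transfer T c φ h) := by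
  intro G hG
  have key : ∀ l, ∃ v, Tendsto (branchTransfer T c φ l h) G (𝓝 v) := by
    intro l
    rcases hG.mem_or_compl_mem (hc.ordConnected_image l) with hl | hl
    · obtain ⟨F, hF, hFG⟩ := hc.exists_tendsto_invFunOn hG hl
      obtain ⟨p, hp⟩ := hφ.isRegulated hc F hF
      obtain ⟨v, hv⟩ := hh F hF
      exact ⟨_, tendsto_branchTransfer hl hFG hp hv⟩
    · exact ⟨0, tendsto_const_nhds.congr' (branchTransfer_eventuallyEq_zero hl h).symm⟩
  choose v hv using key
  refine ⟨∑ l, v l, ?_⟩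
  rw [transfer_eq_sum, show (∑ l, branchTransfer T c φ l h) =
    fun x => ∑ l, branchTransfer T c φ l h x from funext fun x => Finset.sum_apply _ _ _]
  exact tendsto_finsetSum _ fun l _ => hv l

/-- Interior points: the branch through `y` carries a jump at `y` to a jump at `T y`, multiplied
by `φ y` and by the sign of the orientation of the branch. -/
theorem exists_hasJump_branchTransfer (hc : IsMonotonePartition T c)
    (hφ : IsPiecewiseContinuous c φ) {l : Fin N} {y : unitInterval} (hy : y ∈ branch c l) :
    ∃ σ : ℂ, ‖σ‖ = 1 ∧ ∀ h d, HasJump h y d →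
      HasJump (branchTransfer T c φ l h) (T y) (σ * φ y * d) := by
  have hS := hc.image_branch_mem_nhds hy
  have hg : Tendsto (Function.invFunOn T (branch c l)) (𝓝 (T y)) (𝓝 y) := by
    have := hc.continuousAt_invFunOn hy
    rwa [ContinuousAt, hc.invFunOn_apply hy] at this
  have hTy : T y ∈ T '' branch c l := mem_image_of_mem T hy
  have hφR : Tendsto φ (𝓝[>] y) (𝓝 (φ y)) :=
    (hφ.continuousAt hy).tendsto.mono_left nhdsWithin_le_nhds
  have hφL : Tendsto φ (𝓝[<] y) (𝓝 (φ y)) :=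
    (hφ.continuousAt hy).tendsto.mono_left nhdsWithin_le_nhds
  have hSR : T '' branch c l ∈ 𝓝[>] (T y) := mem_nhdsWithin_of_mem_nhds hS
  have hSL : T '' branch c l ∈ 𝓝[<] (T y) := mem_nhdsWithin_of_mem_nhds hS
  rcases hc.invFunOn_strictMonoOn l with ⟨-, hm⟩ | ⟨-, hm⟩
  · have hR : Tendsto (Function.invFunOn T (branch c l)) (𝓝[>] (T y)) (𝓝[>] y) := by
      refine tendsto_nhdsWithin_iff.2 ⟨hg.mono_left nhdsWithin_le_nhds, ?_⟩
      filter_upwards [hSR, self_mem_nhdsWithin] with t ht hty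
      have := hm hTy ht hty
      rwa [hc.invFunOn_apply hy] at this
    have hL : Tendsto (Function.invFunOn T (branch c l)) (𝓝[<] (T y)) (𝓝[<] y) := by
      refine tendsto_nhdsWithin_iff.2 ⟨hg.mono_left nhdsWithin_le_nhds, ?_⟩
      filter_upwards [hSL, self_mem_nhdsWithin] with t ht hty
      have := hm ht hTy hty
      rwa [hc.invFunOn_apply hy] at this
    refine ⟨1, norm_one, ?_⟩
    rintro h d ⟨u, v, hu, hv, rfl⟩
    exact ⟨_, _, tendsto_branchTransfer hSR hR hφR hu, tendsto_branchTransfer hSL hL hφL hv,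
      by ring⟩
  · have hR : Tendsto (Function.invFunOn T (branch c l)) (𝓝[>] (T y)) (𝓝[<] y) := by
      refine tendsto_nhdsWithin_iff.2 ⟨hg.mono_left nhdsWithin_le_nhds, ?_⟩
      filter_upwards [hSR, self_mem_nhdsWithin] with t ht hty
      have := hm hTy ht hty
      rwa [hc.invFunOn_apply hy] at this
    have hL : Tendsto (Function.invFunOn T (branch c l)) (𝓝[<] (T y)) (𝓝[>] y) := by
      refine tendsto_nhdsWithin_iff.2 ⟨hg.mono_left nhdsWithin_le_nhds, ?_⟩
      filter_upwards [hSL, self_mem_nhdsWithin] with t ht hty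
      have := hm ht hTy hty
      rwa [hc.invFunOn_apply hy] at this
    refine ⟨-1, by simp, ?_⟩
    rintro h d ⟨u, v, hu, hv, rfl⟩
    exact ⟨_, _, tendsto_branchTransfer hSR hR hφL hv, tendsto_branchTransfer hSL hL hφR hu,
      by ring⟩

/-- The forward orbits of all the one-sided points at the ends of the branches. -/
def postcriticalSet (T : unitInterval → unitInterval) {N : ℕ} (c : Fin (N + 1) → unitInterval) :
    Set unitInterval :=
  {x | ∃ l, ∃ b ∈ frontier (branch c l), ∃ k, x = boundaryOrbit T c l b k}

theorem apply_mem_postcriticalSet (hc : IsMonotonePartition T c) {l : Fin N} {y : unitInterval}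
    (hy : y ∈ branch c l) (hyP : y ∈ postcriticalSet T c) : T y ∈ postcriticalSet T c := by
  obtain ⟨j, b, hb, k, rfl⟩ := hyP
  exact ⟨j, b, hb, k + 1, (boundaryOrbit_succ hc hb hy).symm⟩

/-- The functions in the span of the iterates have one-sided limits everywhere, and jump only on
the postcritical set. -/
theorem iterateSpan_regular (hc : IsMonotonePartition T c) (hφ : IsPiecewiseContinuous c φ)
    {h : unitInterval → ℂ} (hh : h ∈ iterateSpan T c φ) :
    IsRegulated h ∧ ∀ x ∉ postcriticalSet T c, HasJump h x 0 := by
  induction hh using Submodule.span_induction with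
  | mem f hf =>
    obtain ⟨_, ⟨n, rfl⟩, g, hg, rfl⟩ := hf
    have hpc := isPiecewiseContinuous_of_mem_piecewiseSmooth hg
    induction n with
    | zero =>
      refine ⟨hpc.isRegulated hc, fun x hx => ?_⟩
      obtain ⟨j, hj | hj⟩ := hc.exists_mem_branch_or_mem_frontier x
      · exact (hpc.continuousAt hj).hasJump
      · exact absurd ⟨j, x, hj, 0, (boundaryOrbit_zero hc hj).symm⟩ hx
    | succ n ih =>
      rw [Function.iterate_succ_apply']
      refine ⟨isRegulated_transfer hc hφ ih.1, fun x hx => ?_⟩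
      rw [transfer_eq_sum]
      have : HasJump (∑ l, branchTransfer T c φ l ((transfer T c φ)^[n] g)) x
          (∑ l : Fin N, (0 : ℂ)) := by
        refine HasJump.sum fun l _ => ?_
        rcases hc.compl_image_mem_or_exists (l := l) (x := x)
          (fun b hb e => hx ⟨l, b, hb, 1, e⟩) with hS | ⟨y, hy, rfl⟩
        · exact (hasJump_zero x).congr (branchTransfer_eventuallyEq_zero hS _).symm
        · obtain ⟨σ, -, hσ⟩ := exists_hasJump_branchTransfer hc hφ hy
          have := hσ _ 0 (ih.2 y fun hyP => hx (apply_mem_postcriticalSet hc hy hyP))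
          rwa [mul_zero] at this
      simpa using this
  | zero => exact ⟨fun F _ => ⟨0, tendsto_const_nhds⟩, fun x _ => hasJump_zero x⟩
  | add f g _ _ hf hg =>
    refine ⟨fun F hF => ?_, fun x hx => by simpa using (hf.2 x hx).add (hg.2 x hx)⟩
    obtain ⟨u, hu⟩ := hf.1 F hF
    obtain ⟨v, hv⟩ := hg.1 F hF
    exact ⟨_, hu.add hv⟩
  | smul r f _ hf =>
    refine ⟨fun F hF => ?_, fun x hx => by simpa using (hf.2 x hx).const_smul r⟩
    obtain ⟨u, hu⟩ := hf.1 F hF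
    exact ⟨_, hu.const_smul r⟩

end Transfer

/-! ### The orbit of a non-trivial discontinuity -/

/-- An eventually periodic sequence has finitely many values. -/
theorem finite_range_of_forall_add_eq {α : Type*} {f : ℕ → α} {j k : ℕ} (hjk : j < k)
    (h : ∀ i, f (j + i) = f (k + i)) : (range f).Finite := by
  refine ((finite_Iio k).image f).subset ?_
  rintro _ ⟨n, rfl⟩
  induction n using Nat.strong_induction_on with
  | _ n ih =>
    rcases lt_or_ge n k with hn | hn
    · exact mem_image_of_mem f hn
    · obtain ⟨i, rfl⟩ := Nat.exists_eq_add_of_le hn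
      rw [← h i]
      exact ih _ (by omega)

section Orbit

variable {T : unitInterval → unitInterval} {N : ℕ} {c : Fin (N + 1) → unitInterval}

theorem IsMonotonePartition.mem_range_of_mem_frontier (hc : IsMonotonePartition T c) {l : Fin N}
    {b : unitInterval} (hb : b ∈ frontier (branch c l)) : b ∈ range c := by
  rw [branch, frontier_Ioo (hc.strictMono (Fin.castSucc_lt_succ (i := l)))] at hb
  rcases hb with rfl | rfl <;> exact mem_range_self _

theorem IsMonotonePartition.notMem_branch_of_mem_frontier (hc : IsMonotonePartition T c)
    {l : Fin N} {b : unitInterval} (hb : b ∈ frontier (branch c l)) (j : Fin N) :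
    b ∉ branch c j := by
  obtain ⟨i, rfl⟩ := hc.mem_range_of_mem_frontier hb
  rintro ⟨h1, h2⟩
  have h1 := hc.strictMono.lt_iff_lt.1 h1
  have h2 := hc.strictMono.lt_iff_lt.1 h2
  rw [Fin.lt_def] at h1 h2
  simp at h1 h2
  omega

theorem isGerm_nhdsWithin_branch (hc : IsMonotonePartition T c) {l : Fin N} {a : unitInterval}
    (ha : a ∈ frontier (branch c l)) : IsGerm (𝓝[branch c l] a) := by
  rcases nhdsWithin_branch hc.strictMono ha with ⟨e, hn⟩ | ⟨e, hn⟩ <;> rw [e]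
  · exact ⟨hn, a, Or.inl rfl⟩
  · exact ⟨hn, a, Or.inr rfl⟩

theorem IsMonotonePartition.exists_tendsto_iterate (hc : IsMonotonePartition T c)
    {F : Filter unitInterval} (hF : IsGerm F) (n : ℕ) : ∃ G, IsGerm G ∧ Tendsto (T^[n]) F G := by
  induction n with
  | zero => exact ⟨F, hF, tendsto_id⟩
  | succ n ih =>
    obtain ⟨G, hG, hFG⟩ := ih
    obtain ⟨H, hH, hGH⟩ := hc.exists_tendsto hG
    rw [Function.iterate_succ']
    exact ⟨H, hH, hGH.comp hFG⟩

theorem infinite_range_boundaryOrbit {l : Fin N} {a : unitInterval}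
    (ha : IsNontrivialDiscontinuity T c l a) : (range (boundaryOrbit T c l a)).Infinite :=
  ha.2.mono (image_subset_range _ _)

/-- The orbit of a non-trivial discontinuity eventually stays in the interiors of the branches:
the one-sided points that it visits are distinct, and there are finitely many at the ends of
the branches. -/
theorem eventually_boundaryOrbit_mem_branch (hc : IsMonotonePartition T c) {l : Fin N}
    {a : unitInterval} (ha : IsNontrivialDiscontinuity T c l a) :
    ∃ K, ∀ k, K ≤ k → ∃ j, boundaryOrbit T c l a k ∈ branch c j := by
  have hF := isGerm_nhdsWithin_branch hc ha.1
  have := hF.1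
  choose G hG hFG using fun k => hc.exists_tendsto_iterate hF k
  have hGinj : Function.Injective G := by
    have key : ∀ j k, j < k → G j ≠ G k := by
      intro j k hjk he
      refine infinite_range_boundaryOrbit ha (finite_range_of_forall_add_eq hjk fun i => ?_)
      obtain ⟨H, hH, hGH⟩ := hc.exists_tendsto_iterate (hG j) i
      obtain ⟨z, hHz⟩ : ∃ z, H ≤ 𝓝 z := by
        obtain ⟨-, z, rfl | rfl⟩ := hH <;> exact ⟨z, nhdsWithin_le_nhds⟩
      have h1 : ∀ m, G m = G j → boundaryOrbit T c l a (m + i) = z := by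
        intro m hm
        refine tendsto_nhds_unique (tendsto_boundaryOrbit hc ha.1 (m + i)) ?_
        rw [add_comm, Function.iterate_add]
        exact (hGH.mono_right hHz).comp (hm ▸ hFG m)
      rw [h1 j rfl, h1 k he.symm]
    intro j k he
    by_contra hne
    rcases Nat.lt_or_gt_of_ne hne with h | h
    · exact key _ _ h he
    · exact key _ _ h he.symm
  have hfin : {k | ¬ ∃ j, boundaryOrbit T c l a k ∈ branch c j}.Finite := by
    have hS : ((fun x => 𝓝[>] x) '' range c ∪ (fun x => 𝓝[<] x) '' range c).Finite :=
      ((finite_range c).image _).union ((finite_range c).image _)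
    refine (hS.preimage hGinj.injOn).subset fun k hk => ?_
    obtain ⟨j, hj | hj⟩ := hc.exists_mem_branch_or_mem_frontier (boundaryOrbit T c l a k)
    · exact absurd ⟨j, hj⟩ hk
    · have hr := hc.mem_range_of_mem_frontier hj
      obtain ⟨-, x, hx⟩ := hG k
      have hGx : G k ≤ 𝓝 x := by rcases hx with hx | hx <;> rw [hx] <;> exact nhdsWithin_le_nhds
      rw [tendsto_nhds_unique (tendsto_boundaryOrbit hc ha.1 k) ((hFG k).mono_right hGx)] at hr
      exact hx.imp (fun h => ⟨x, hr, h.symm⟩) fun h => ⟨x, hr, h.symm⟩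
  obtain ⟨M, hM⟩ := hfin.bddAbove
  refine ⟨M + 1, fun k hk => ?_⟩
  by_contra hcon
  have := hM hcon
  omega

/-- Far along the orbit of a non-trivial discontinuity, the only way in which a postcritical orbit
enters the orbit is along the orbit itself: each of the finitely many other boundary orbits joins it
at most once. -/
theorem exists_forall_boundaryOrbit_eq (hc : IsMonotonePartition T c) {l : Fin N}
    {a : unitInterval} (ha : IsNontrivialDiscontinuity T c l a) :
    ∃ K, (∀ k, K ≤ k → ∃ j, boundaryOrbit T c l a k ∈ branch c j) ∧
      ∀ k, K ≤ k → ∀ i, ∀ b ∈ frontier (branch c i), ∀ m,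
        boundaryOrbit T c i b (m + 1) = boundaryOrbit T c l a (k + 1) →
          boundaryOrbit T c i b m = boundaryOrbit T c l a k := by
  obtain ⟨K₁, hK₁⟩ := eventually_boundaryOrbit_mem_branch hc ha
  -- once two boundary orbits meet at a late point of the orbit of `a`, they agree from then on
  have hfollow : ∀ i, ∀ b ∈ frontier (branch c i), ∀ m k, K₁ ≤ k →
      boundaryOrbit T c i b m = boundaryOrbit T c l a k → ∀ n,
        boundaryOrbit T c i b (m + n) = boundaryOrbit T c l a (k + n) := by
    intro i b hb m k hk he n
    induction n with
    | zero => exact he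
    | succ n ih =>
      obtain ⟨j, hj⟩ := hK₁ (k + n) (by omega)
      rw [← add_assoc, ← add_assoc, boundaryOrbit_succ hc ha.1 hj,
        boundaryOrbit_succ hc hb (ih ▸ hj), ih]
  have hinj : ∀ j k, K₁ ≤ j → K₁ ≤ k →
      boundaryOrbit T c l a j = boundaryOrbit T c l a k → j = k := by
    have key : ∀ j k, K₁ ≤ j → K₁ ≤ k → j < k →
        boundaryOrbit T c l a j ≠ boundaryOrbit T c l a k := fun j k _ hk hjk he =>
      infinite_range_boundaryOrbit ha
        (finite_range_of_forall_add_eq hjk (hfollow l a ha.1 j k hk he))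
    intro j k hj hk he
    by_contra hne
    rcases Nat.lt_or_gt_of_ne hne with h | h
    · exact key _ _ hj hk h he
    · exact key _ _ hk hj h he.symm
  have hone : ∀ p : Fin N × unitInterval, ∃ K, K₁ ≤ K ∧ (p.2 ∈ frontier (branch c p.1) →
      ∀ k, K ≤ k → ∀ m, boundaryOrbit T c p.1 p.2 (m + 1) = boundaryOrbit T c l a (k + 1) →
        boundaryOrbit T c p.1 p.2 m = boundaryOrbit T c l a k) := by
    classical
    rintro ⟨i, b⟩
    by_cases hhit : ∃ m k, K₁ ≤ k ∧ boundaryOrbit T c i b m = boundaryOrbit T c l a k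
    · -- from the first meeting on the orbits agree, and the orbit of `a` has no repetitions
      obtain ⟨k₀, hk₀, he₀⟩ := Nat.find_spec hhit
      refine ⟨k₀, hk₀, fun hb k hk m hm => ?_⟩
      have h1 : Nat.find hhit ≤ m + 1 := Nat.find_min' hhit ⟨k + 1, by omega, hm⟩
      rcases h1.eq_or_lt with h1 | h1
      · rw [← h1, he₀] at hm
        have := hinj _ _ hk₀ (by omega) hm
        omega
      · obtain ⟨n, rfl⟩ := Nat.exists_eq_add_of_le (Nat.lt_succ_iff.1 h1)
        have h2 := hfollow i b hb _ _ hk₀ he₀ (n + 1)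
        rw [add_assoc] at hm
        have h3 := hinj _ _ (by omega) (by omega) (h2.symm.trans hm)
        rw [hfollow i b hb _ _ hk₀ he₀ n]
        congr 1
        omega
    · exact ⟨K₁, le_rfl, fun _ k hk m hm => absurd ⟨m + 1, k + 1, by omega, hm⟩ hhit⟩
  choose K hK₁K hK using hone
  have hfin : ((fun p => K p) '' ((univ : Set (Fin N)) ×ˢ range c)).Finite :=
    (finite_univ.prod (finite_range c)).image _
  obtain ⟨M, hM⟩ := hfin.bddAbove
  refine ⟨max K₁ M, fun k hk => hK₁ k (le_of_max_le_left hk), fun k hk i b hb m hm => ?_⟩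
  refine hK (i, b) hb k (le_trans (hM (mem_image_of_mem _ ?_)) (le_of_max_le_right hk)) m hm
  exact ⟨mem_univ _, hc.mem_range_of_mem_frontier hb⟩

/-! ### Jumps along the orbit -/

theorem boundaryWeight_eq (hc : IsMonotonePartition T c) {φ : unitInterval → ℂ}
    (hφ : IsPiecewiseContinuous c φ) {l j : Fin N} {a : unitInterval}
    (ha : a ∈ frontier (branch c l)) {k : ℕ} (hk : boundaryOrbit T c l a k ∈ branch c j) :
    boundaryWeight T c φ l a k = φ (boundaryOrbit T c l a k) := by
  have := (isGerm_nhdsWithin_branch hc ha).1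
  exact tendsto_nhds_unique (tendsto_boundaryWeight hc hφ ha k)
    ((hφ.continuousAt hk).tendsto.comp (tendsto_boundaryOrbit hc ha k))

/-- The transfer operator carries the jump at `x` to the jump at `T x`, up to a factor of modulus
`|φ x|`, if `T x` has no postcritical preimage other than `x`. -/
theorem exists_hasJump_transfer (hc : IsMonotonePartition T c) {φ : unitInterval → ℂ}
    (hφ : IsPiecewiseContinuous c φ) {j : Fin N} {x : unitInterval} (hx : x ∈ branch c j)
    (hxb : ∀ i, ∀ b ∈ frontier (branch c i), T x ≠ boundaryOrbit T c i b 1)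
    (hxP : ∀ y ∈ postcriticalSet T c, ∀ i, y ∈ branch c i → T y = T x → y = x) :
    ∃ β : ℂ, ‖β‖ = ‖φ x‖ ∧ ∀ h ∈ iterateSpan T c φ, ∀ d, HasJump h x d →
      HasJump (transfer T c φ h) (T x) (β * d) := by
  classical
  obtain ⟨σ, hσ1, hσ⟩ := exists_hasJump_branchTransfer hc hφ hx
  refine ⟨σ * φ x, by rw [norm_mul, hσ1, one_mul], fun h hh d hd => ?_⟩
  have : HasJump (∑ i, branchTransfer T c φ i h) (T x)
      (∑ i : Fin N, if i = j then σ * φ x * d else 0) := by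
    refine HasJump.sum fun i _ => ?_
    split_ifs with hij
    · subst hij
      exact hσ h d hd
    · rcases hc.compl_image_mem_or_exists (hxb i) with hS | ⟨y, hy, hyx⟩
      · exact (hasJump_zero _).congr (branchTransfer_eventuallyEq_zero hS h).symm
      · obtain ⟨τ, -, hτ⟩ := exists_hasJump_branchTransfer hc hφ hy
        have hyP : y ∉ postcriticalSet T c := by
          intro hyP
          obtain rfl := hxP y hyP i hy hyx
          exact hij (hc.eq_of_mem_branch hy hx)
        have := hτ h 0 ((iterateSpan_regular hc hφ hh).2 y hyP)
        rwa [mul_zero, hyx] at this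
  simpa [transfer_eq_sum] using this

/-! ### Functions concentrated at a boundary point -/

/-- Smooth bumps at `a`, cut off outside `ω_l`, whose supports shrink to `a`. -/
noncomputable def oneSidedBump (c : Fin (N + 1) → unitInterval) (l : Fin N) (a : unitInterval)
    (i : ℕ) : unitInterval → ℂ :=
  (branch c l).indicator fun x =>
    (((⟨1 / (i + 1) / 2, 1 / (i + 1), by positivity, half_lt_self (by positivity)⟩ :
      ContDiffBump (a : ℝ)) (x : ℝ) : ℝ) : ℂ)

theorem oneSidedBump_mem_piecewiseSmooth (hc : IsMonotonePartition T c) (l : Fin N)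
    (a : unitInterval) (i : ℕ) : oneSidedBump c l a i ∈ piecewiseSmooth c := by
  intro j
  by_cases hj : j = l
  · subst hj
    refine ⟨fun x => _, Complex.ofRealCLM.contDiff.comp (ContDiffBump.contDiff
      (⟨1 / (i + 1) / 2, 1 / (i + 1), by positivity, half_lt_self (by positivity)⟩ :
      ContDiffBump (a : ℝ))), fun x hx => ?_⟩
    exact indicator_of_mem hx _
  · exact ⟨fun _ => 0, contDiff_const, fun x hx =>
      indicator_of_notMem (fun hx' => hj (hc.eq_of_mem_branch hx hx')) _⟩

theorem oneSidedBump_eventuallyEq_one (c : Fin (N + 1) → unitInterval) (l : Fin N)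
    (a : unitInterval) (i : ℕ) : oneSidedBump c l a i =ᶠ[𝓝[branch c l] a] 1 := by
  have h : Metric.closedBall a (1 / ((i : ℝ) + 1) / 2) ∈ 𝓝[branch c l] a :=
    mem_nhdsWithin_of_mem_nhds (Metric.closedBall_mem_nhds a (by positivity))
  filter_upwards [h, self_mem_nhdsWithin] with x hx hxl
  rw [oneSidedBump, indicator_of_mem hxl, ContDiffBump.one_of_mem_closedBall]
  · simp
  · exact hx

theorem oneSidedBump_eventuallyEq_zero (hc : IsMonotonePartition T c) {l : Fin N}
    {a : unitInterval} (ha : a ∈ frontier (branch c l)) {G : Filter unitInterval} (hG : IsGerm G)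
    (hGa : G ≠ 𝓝[branch c l] a) : ∀ᶠ i in atTop, oneSidedBump c l a i =ᶠ[G] 0 := by
  have := hG.1
  by_cases hGl : (branch c l)ᶜ ∈ G
  · refine Eventually.of_forall fun i => ?_
    filter_upwards [hGl] with x hx using indicator_of_notMem hx _
  · have hl : branch c l ∈ G := (hG.mem_or_compl_mem ordConnected_Ioo).resolve_right hGl
    obtain ⟨y, hy⟩ : ∃ y, G ≤ 𝓝 y := by
      obtain ⟨-, y, rfl | rfl⟩ := hG <;> exact ⟨y, nhdsWithin_le_nhds⟩
    have hya : y ≠ a := by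
      rintro rfl
      exact hGa (hG.eq_of_le_of_le (isGerm_nhdsWithin_branch hc ha) le_rfl
        (le_inf hy (le_principal_iff.2 hl)))
    have hlim : Tendsto (fun i : ℕ => 1 / ((i : ℝ) + 1)) atTop (𝓝 0) :=
      tendsto_one_div_add_atTop_nhds_zero_nat
    have hd : 0 < dist y a / 2 := half_pos (dist_pos.2 hya)
    filter_upwards [hlim.eventually (gt_mem_nhds hd)] with i hi
    have hnear : ∀ᶠ x in G, dist y a / 2 < dist x a :=
      hy ((isOpen_lt continuous_const (continuous_id.dist continuous_const)).mem_nhds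
        (half_lt_self (dist_pos.2 hya)))
    filter_upwards [hnear, hl] with x hx hxl
    rw [oneSidedBump, indicator_of_mem hxl, ContDiffBump.zero_of_le_dist]
    · simp
    · exact (hi.trans hx).le

open Classical in
/-- Under the iterates of the transfer operator, a function concentrated at the one-sided point `a`
has, at each given one-sided point, the limit `∏_{k<n} φ(T^k a)` if this is the one-sided point
`T^n a`, and the limit `0` otherwise. -/
theorem tendsto_transfer_iterate_oneSidedBump (hc : IsMonotonePartition T c)
    {φ : unitInterval → ℂ} (hφ : IsPiecewiseContinuous c φ) {l : Fin N} {a : unitInterval}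
    (ha : a ∈ frontier (branch c l)) (n : ℕ)
    {G : Filter unitInterval} (hG : IsGerm G) :
    ∀ᶠ i in atTop, Tendsto ((transfer T c φ)^[n] (oneSidedBump c l a i)) G
      (𝓝 (if Tendsto (T^[n]) (𝓝[branch c l] a) G then
        ∏ k ∈ Finset.range n, boundaryWeight T c φ l a k else 0)) := by
  have hF := isGerm_nhdsWithin_branch hc ha
  have := hF.1
  induction n generalizing G with
  | zero =>
    by_cases h : Tendsto (T^[0]) (𝓝[branch c l] a) G
    · obtain rfl := hF.eq_of_le_of_le hG le_rfl h
      refine Eventually.of_forall fun i => ?_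
      rw [if_pos h, Finset.prod_range_zero]
      exact tendsto_const_nhds.congr' (oneSidedBump_eventuallyEq_one c l a i).symm
    · have hne : G ≠ 𝓝[branch c l] a := fun he => h (he ▸ tendsto_id)
      filter_upwards [oneSidedBump_eventuallyEq_zero hc ha hG hne] with i hi
      rw [if_neg h]
      exact tendsto_const_nhds.congr' hi.symm
  | succ n ih =>
    have := hG.1
    obtain ⟨F, hFg, hTF⟩ := hc.exists_tendsto_iterate hF n
    obtain ⟨j, hj⟩ := hc.exists_branch_mem hFg
    have key : ∀ m : Fin N, ∀ᶠ i in atTop, Tendsto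
        (branchTransfer T c φ m ((transfer T c φ)^[n] (oneSidedBump c l a i))) G
        (𝓝 (if m = j then if Tendsto (T^[n + 1]) (𝓝[branch c l] a) G then
          ∏ k ∈ Finset.range (n + 1), boundaryWeight T c φ l a k else 0 else 0)) := by
      intro m
      have hval : ∀ v, (m = j → Tendsto (T^[n + 1]) (𝓝[branch c l] a) G → v =
            ∏ k ∈ Finset.range (n + 1), boundaryWeight T c φ l a k) →
          (¬ (m = j ∧ Tendsto (T^[n + 1]) (𝓝[branch c l] a) G) → v = 0) →
          v = if m = j then if Tendsto (T^[n + 1]) (𝓝[branch c l] a) G then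
          ∏ k ∈ Finset.range (n + 1), boundaryWeight T c φ l a k else 0 else 0 := by
        intro v h1 h2
        split_ifs with h3 h4
        · exact h1 h3 h4
        · exact h2 fun h => h4 h.2
        · exact h2 fun h => h3 h.1
      rcases hG.mem_or_compl_mem (hc.ordConnected_image m) with hS | hS
      · obtain ⟨F', hF', hgF'⟩ := hc.exists_tendsto_invFunOn hG hS
        obtain ⟨p, hp⟩ := hφ.isRegulated hc F' hF'
        filter_upwards [ih hF'] with i hi
        -- `F'` is the one-sided point `T^n a` if and only if `m` is the branch that contains it
        -- and `G` is the one-sided point `T^(n + 1) a`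
        have hfwd : m = j → Tendsto (T^[n + 1]) (𝓝[branch c l] a) G →
            Tendsto (T^[n]) (𝓝[branch c l] a) F' := by
          rintro rfl h
          refine (hgF'.comp h).congr' ?_
          filter_upwards [hTF hj] with y hy
          rw [Function.comp_apply, Function.iterate_succ_apply', hc.invFunOn_apply hy]
        have hbwd : Tendsto (T^[n]) (𝓝[branch c l] a) F' →
            m = j ∧ Tendsto (T^[n + 1]) (𝓝[branch c l] a) G := by
          intro h
          obtain rfl : F' = F :=
            hF'.eq_of_le_of_le hFg (H := map (T^[n]) (𝓝[branch c l] a)) h hTF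
          obtain ⟨H, hH, hFH⟩ := hc.exists_tendsto hF'
          have hGH : Tendsto id G H := by
            refine (hFH.comp hgF').congr' ?_
            filter_upwards [hS] with x hx using apply_invFunOn_branch hx
          obtain rfl : G = H := hG.eq_of_le_of_le hH le_rfl hGH
          refine ⟨?_, by rw [Function.iterate_succ']; exact hFH.comp hTF⟩
          obtain ⟨x, hxS, hxj⟩ := Filter.nonempty_of_mem (inter_mem hS (hgF' hj))
          exact hc.eq_of_mem_branch (invFunOn_mem_branch hxS) hxj
        rw [← hval _ ?_ ?_]
        · exact tendsto_branchTransfer hS hgF' hp hi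
        · intro h1 h2
          have h3 := hfwd h1 h2
          rw [if_pos h3, Finset.prod_range_succ, mul_comm,
            tendsto_nhds_unique (tendsto_boundaryWeight hc hφ ha n) (hp.comp h3)]
        · intro h
          rw [if_neg fun h3 => h (hbwd h3), mul_zero]
      · refine Eventually.of_forall fun i => ?_
        rw [← hval 0 ?_ fun _ => rfl]
        · exact tendsto_const_nhds.congr' (branchTransfer_eventuallyEq_zero hS _).symm
        · rintro rfl h
          have h1 : ∀ᶠ y in 𝓝[branch c l] a, T^[n + 1] y ∈ T '' branch c m := by
            filter_upwards [hTF hj] with y hy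
            rw [Function.iterate_succ_apply']
            exact mem_image_of_mem T hy
          obtain ⟨y, hy1, hy2⟩ := (h1.and (h hS)).exists
          exact absurd hy1 hy2
    filter_upwards [eventually_all.2 key] with i hi
    rw [Function.iterate_succ_apply', transfer_eq_sum, show (∑ m, branchTransfer T c φ m
      ((transfer T c φ)^[n] (oneSidedBump c l a i))) = fun x => ∑ m, branchTransfer T c φ m
      ((transfer T c φ)^[n] (oneSidedBump c l a i)) x from funext fun x => Finset.sum_apply _ _ _]
    have := tendsto_finsetSum Finset.univ fun m _ => hi m
    simpa using this

/-- A function concentrated near the one-sided point `a` acquires a jump at `T^n a` after `n`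
iterations, provided that `T^n a` is an interior point. -/
theorem exists_hasJump_iterate (hc : IsMonotonePartition T c) {φ : unitInterval → ℂ}
    (hφ : IsPiecewiseContinuous c φ) {l : Fin N} {a : unitInterval}
    (ha : a ∈ frontier (branch c l)) {n : ℕ} (h0 : 0 < boundaryOrbit T c l a n)
    (h1 : boundaryOrbit T c l a n < 1)
    (hw : ∀ k < n, boundaryWeight T c φ l a k ≠ 0) :
    ∃ h ∈ piecewiseSmooth c, ∃ d ≠ 0,
      HasJump ((transfer T c φ)^[n] h) (boundaryOrbit T c l a n) d := by
  classical
  have hF := isGerm_nhdsWithin_branch hc ha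
  have := hF.1
  set x := boundaryOrbit T c l a n with hx
  have hR : IsGerm (𝓝[>] x) := ⟨nhdsGT_neBot_of_exists_gt ⟨_, h1⟩, x, Or.inl rfl⟩
  have hL : IsGerm (𝓝[<] x) := ⟨nhdsLT_neBot_of_exists_lt ⟨_, h0⟩, x, Or.inr rfl⟩
  obtain ⟨i, hiR, hiL⟩ := ((tendsto_transfer_iterate_oneSidedBump hc hφ ha n hR).and
    (tendsto_transfer_iterate_oneSidedBump hc hφ ha n hL)).exists
  refine ⟨_, oneSidedBump_mem_piecewiseSmooth hc l a i, _, ?_, _, _, hiR, hiL, rfl⟩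
  have hW : ∏ k ∈ Finset.range n, boundaryWeight T c φ l a k ≠ 0 :=
    Finset.prod_ne_zero_iff.2 fun k hk => hw k (Finset.mem_range.1 hk)
  have hnot : ¬ (Tendsto (T^[n]) (𝓝[branch c l] a) (𝓝[>] x) ∧
      Tendsto (T^[n]) (𝓝[branch c l] a) (𝓝[<] x)) := by
    rintro ⟨hr, hl⟩
    obtain ⟨y, hy1, hy2⟩ := Filter.nonempty_of_mem (inter_mem (hr self_mem_nhdsWithin)
      (hl self_mem_nhdsWithin))
    exact lt_asymm (mem_Ioi.1 hy1) (mem_Iio.1 hy2)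
  have hor : Tendsto (T^[n]) (𝓝[branch c l] a) (𝓝[>] x) ∨
      Tendsto (T^[n]) (𝓝[branch c l] a) (𝓝[<] x) := by
    obtain ⟨y, hy⟩ := exists_tendsto_iterate hc ha n
    obtain rfl : x = y := by
      refine tendsto_nhds_unique (tendsto_boundaryOrbit hc ha n) ?_
      rcases hy with hy | hy <;> exact hy.mono_right nhdsWithin_le_nhds
    exact hy
  rcases hor with h | h
  · rw [if_pos h, if_neg fun h' => hnot ⟨h, h'⟩, sub_zero]
    exact hW
  · rw [if_neg fun h' => hnot ⟨h', h⟩, if_pos h, zero_sub]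
    exact neg_ne_zero.2 hW

/-! ### Jumps as functionals on the Banach space -/

/-- A norm that dominates the essential supremum dominates the jumps, which therefore extend to
functionals on the whole Banach space. -/
theorem exists_jump_functional (hc : IsMonotonePartition T c) {φ : unitInterval → ℂ}
    (hφ : IsPiecewiseContinuous c φ) {B : Type*} [NormedAddCommGroup B] [NormedSpace ℂ B]
    (ι : iterateSpan T c φ →ₗ[ℂ] B)
    (hι : ∀ h : iterateSpan T c φ, eLpNorm (h : unitInterval → ℂ) ∞ volume ≤ ‖ι h‖ₑ)
    {x : unitInterval} (h0 : 0 < x) (h1 : x < 1) :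
    ∃ ψ : B →L[ℂ] ℂ, ‖ψ‖ ≤ 2 ∧ ∀ h : iterateSpan T c φ, HasJump h x (ψ (ι h)) := by
  -- jumps are unique at interior points, hence depend linearly on the function
  choose J hJ using fun h : iterateSpan T c φ =>
    (iterateSpan_regular hc hφ h.2).1.exists_hasJump x
  let Jl : iterateSpan T c φ →ₗ[ℂ] ℂ :=
    { toFun := J
      map_add' := fun f g => (hJ (f + g)).unique h0 h1 ((hJ f).add (hJ g))
      map_smul' := fun r f => (hJ (r • f)).unique h0 h1 ((hJ f).const_smul r) }
  have hbound : ∀ h, ‖Jl h‖ ≤ 2 * ‖ι h‖ := by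
    intro h
    have h2 : ‖J h‖ₑ ≤ 2 * ‖ι h‖ₑ :=
      ((hJ h).enorm_le h0 h1).trans (mul_le_mul_right (hι h) 2)
    have h3 : ‖J h‖ₑ ≤ ‖(2 : ℝ) * ‖ι h‖‖ₑ := by
      rw [enorm_mul, enorm_norm]
      refine h2.trans_eq ?_
      congr 1
      simp [enorm_eq_nnnorm]
    have h4 := enorm_le_iff_norm_le.1 h3
    rwa [Real.norm_of_nonneg (by positivity)] at h4
  -- `ι` need not be injective, but the jump vanishes on its kernel, so that any section will do
  obtain ⟨s, hs⟩ := ι.rangeRestrict.exists_rightInverse_of_surjective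
    (LinearMap.range_rangeRestrict ι)
  have hs' : ∀ y : LinearMap.range ι, ι (s y) = y := fun y =>
    congrArg Subtype.val (LinearMap.congr_fun hs y)
  let f : LinearMap.range ι →L[ℂ] ℂ := (Jl ∘ₗ s).mkContinuous 2 fun y => by
    have := hbound (s y)
    rwa [hs' y] at this
  obtain ⟨ψ, hψ, hψn⟩ := exists_extension_norm_eq (LinearMap.range ι) f
  refine ⟨ψ, hψn.trans_le (LinearMap.mkContinuous_norm_le _ zero_le_two _), fun h => ?_⟩
  have h2 : ψ (ι h) = J h := by
    have h3 : ψ (ι h) = Jl (s ⟨ι h, LinearMap.mem_range_self ι h⟩) :=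
      hψ ⟨ι h, LinearMap.mem_range_self ι h⟩
    rw [h3, ← sub_eq_zero, show J h = Jl h from rfl, ← map_sub]
    refine norm_le_zero_iff.1 ((hbound _).trans_eq ?_)
    rw [map_sub, hs']
    simp
  rw [h2]
  exact hJ h

end Orbit

/-! ### The growth of the weights -/

theorem ne_zero_of_liminf_norm_prod_pos {w : ℕ → ℂ} {Λ : ℝ}
    (hw : Λ = liminf (fun n : ℕ => ‖∏ k ∈ Finset.Icc 1 n, w k‖ ^ (1 / (n : ℝ))) atTop)
    (hΛ : 0 < Λ) (k : ℕ) (hk : 1 ≤ k) : w k ≠ 0 := by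
  have hev := eventually_lt_of_lt_liminf (hw ▸ hΛ)
    (isBoundedUnder_of ⟨0, fun n => Real.rpow_nonneg (norm_nonneg _) _⟩)
  obtain ⟨n, hn, hkn⟩ := (hev.and (eventually_ge_atTop k)).exists
  intro h0
  rw [Finset.prod_eq_zero (Finset.mem_Icc.2 ⟨hk, hkn⟩) h0, norm_zero, Real.zero_rpow] at hn
  · exact lt_irrefl _ hn
  · have : (n : ℝ) ≠ 0 := by
      norm_cast
      omega
    positivity

theorem tendsto_pow_div_prod_norm {w : ℕ → ℂ} {Λ : ℝ}
    (hw : Λ = liminf (fun n : ℕ => ‖∏ k ∈ Finset.Icc 1 n, w k‖ ^ (1 / (n : ℝ))) atTop)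
    (K : ℕ) {r : ℝ} (hr : 0 ≤ r) (hrΛ : r < Λ) :
    Tendsto (fun m : ℕ => r ^ m / ∏ j ∈ Finset.range m, ‖w (K + 1 + j)‖) atTop (𝓝 0) := by
  obtain ⟨s, hrs, hsΛ⟩ := exists_between hrΛ
  have hs : 0 < s := hr.trans_lt hrs
  have hne := ne_zero_of_liminf_norm_prod_pos hw (hs.trans hsΛ)
  have hev := eventually_lt_of_lt_liminf (hw ▸ hsΛ)
    (isBoundedUnder_of ⟨0, fun n => Real.rpow_nonneg (norm_nonneg _) _⟩)
  have hsplit : ∀ m, ‖∏ k ∈ Finset.Icc 1 (K + m), w k‖ =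
      ‖∏ k ∈ Finset.Icc 1 K, w k‖ * ∏ j ∈ Finset.range m, ‖w (K + 1 + j)‖ := by
    intro m
    induction m with
    | zero => simp
    | succ m ih =>
      rw [← add_assoc, Finset.prod_Icc_succ_top (by omega), norm_mul, ih, Finset.prod_range_succ,
        mul_assoc, show K + 1 + m = K + m + 1 by omega]
  set C := ‖∏ k ∈ Finset.Icc 1 K, w k‖
  have hgeom : Tendsto (fun m : ℕ => C / s ^ K * (r / s) ^ m) atTop (𝓝 0) := by
    simpa using (tendsto_pow_atTop_nhds_zero_of_lt_one (div_nonneg hr hs.le)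
      ((div_lt_one hs).2 hrs)).const_mul (C / s ^ K)
  refine tendsto_of_tendsto_of_tendsto_of_le_of_le' tendsto_const_nhds hgeom
    (Eventually.of_forall fun m => by positivity) ?_
  have hev' : ∀ᶠ m : ℕ in atTop, s < ‖∏ k ∈ Finset.Icc 1 (K + m), w k‖ ^ (1 / ((K + m : ℕ) : ℝ)) :=
    (tendsto_add_atTop_nat K |>.congr fun m => add_comm m K).eventually hev
  filter_upwards [hev', eventually_ge_atTop 1] with m hm hm1
  have hpos : 0 < ∏ j ∈ Finset.range m, ‖w (K + 1 + j)‖ :=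
    Finset.prod_pos fun j _ => norm_pos_iff.2 (hne _ (by omega))
  have hpow : s ^ (K + m) ≤ C * ∏ j ∈ Finset.range m, ‖w (K + 1 + j)‖ := by
    rw [← hsplit]
    have h1 := pow_le_pow_left₀ hs.le hm.le (K + m)
    rwa [one_div, Real.rpow_inv_natCast_pow (norm_nonneg _) (by omega)] at h1
  rw [div_le_iff₀ hpos]
  calc r ^ m = s ^ (K + m) * ((r / s) ^ m / s ^ K) := by
        rw [div_pow, pow_add]
        field_simp
    _ ≤ (C * ∏ j ∈ Finset.range m, ‖w (K + 1 + j)‖) * ((r / s) ^ m / s ^ K) := by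
        gcongr
    _ = _ := by ring

/-! ### The essential spectrum of the transfer operator -/

/-- The filled essential spectrum contains the disc: the operator-theoretic criterion is applied to
the jumps at the points `T^k a`, `k > K`, and to a function concentrated near `a` that acquires a
jump at `T^(K + 1) a` after `K + 1` steps. -/
theorem closedBall_lambdaInf_subset_filledEssSpectrum
    {T : unitInterval → unitInterval} {N : ℕ} {c : Fin (N + 1) → unitInterval}
    (hc : IsMonotonePartition T c) {φ : unitInterval → ℂ} (hφ : IsPiecewiseContinuous c φ)
    {B : Type*} [NormedAddCommGroup B] [NormedSpace ℂ B] [CompleteSpace B]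
    (ι : iterateSpan T c φ →ₗ[ℂ] B) (L : B →L[ℂ] B)
    (hL : ∀ h, L (ι h) = ι (transferOnSpan T c φ h))
    (hι : ∀ h : iterateSpan T c φ, eLpNorm (h : unitInterval → ℂ) ∞ volume ≤ ‖ι h‖ₑ)
    {l : Fin N} {a : unitInterval} (ha : IsNontrivialDiscontinuity T c l a)
    (hφa : boundaryWeight T c φ l a 0 ≠ 0) (hΛ : 0 < lambdaInf T c φ l a) :
    Metric.closedBall (0 : ℂ) (lambdaInf T c φ l a) ⊆ filledEssSpectrum L := by
  obtain ⟨K, hK, hKP⟩ := exists_forall_boundaryOrbit_eq hc ha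
  have hw := ne_zero_of_liminf_norm_prod_pos (w := boundaryWeight T c φ l a) rfl hΛ
  have hw' : ∀ k, boundaryWeight T c φ l a k ≠ 0 := by
    intro k
    rcases Nat.eq_zero_or_pos k with rfl | hk
    · exact hφa
    · exact hw k hk
  -- the index is at least `1`, so that the weights along the orbit are those in the product
  let x : ℕ → unitInterval := fun k => boundaryOrbit T c l a (K + 1 + k)
  have hxb : ∀ k, ∃ j, x k ∈ branch c j := fun k => hK _ (by omega)
  have hx0 : ∀ k, 0 < x k := fun k =>
    (unitInterval.nonneg').trans_lt (hxb k).choose_spec.1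
  have hx1 : ∀ k, x k < 1 := fun k => (hxb k).choose_spec.2.trans_le unitInterval.le_one'
  have hxT : ∀ k, T (x k) = x (k + 1) := fun k =>
    (boundaryOrbit_succ hc ha.1 (hxb k).choose_spec).symm
  choose ψ hψ2 hψ using fun k => exists_jump_functional hc hφ ι hι (hx0 k) (hx1 k)
  have hβ : ∀ k, ∃ β : ℂ, ‖β‖ = ‖boundaryWeight T c φ l a (K + 1 + k)‖ ∧
      ∀ h ∈ iterateSpan T c φ, ∀ d, HasJump h (x k) d →
        HasJump (transfer T c φ h) (T (x k)) (β * d) := by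
    intro k
    obtain ⟨j, hj⟩ := hxb k
    rw [boundaryWeight_eq hc hφ ha.1 hj]
    refine exists_hasJump_transfer hc hφ hj ?_ ?_
    · intro i b hb he
      have h1 := hKP (K + 1 + k) (by omega) i b hb 0 (he.symm.trans (hxT k))
      rw [boundaryOrbit_zero hc hb] at h1
      exact hc.notMem_branch_of_mem_frontier hb j (h1 ▸ hj)
    · rintro _ ⟨i', b, hb, m, rfl⟩ i hy hyx
      exact hKP (K + 1 + k) (by omega) i' b hb m
        ((boundaryOrbit_succ hc hb hy).trans (hyx.trans (hxT k)))
  choose β hβn hβ using hβ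
  have hiter : ∀ (n : ℕ) (h : iterateSpan T c φ),
      ((L ^ n) (ι h) = ι ((transferOnSpan T c φ ^ n) h)) ∧
        (((transferOnSpan T c φ ^ n) h : iterateSpan T c φ) : unitInterval → ℂ) =
          (transfer T c φ)^[n] h := by
    intro n h
    induction n with
    | zero => simp
    | succ n ih =>
      constructor
      · rw [pow_succ', mul_apply_eq_comp, ih.1, hL, pow_succ', Module.End.mul_apply]
      · rw [pow_succ', Module.End.mul_apply, Function.iterate_succ_apply', ← ih.2]
        rfl
  -- `x 0 = T^(K + 1) a`, so that the jump appears after exactly `K + 1` iterations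
  obtain ⟨h, hh, d, hd, hjump⟩ := exists_hasJump_iterate hc hφ ha.1 (hx0 0) (hx1 0)
    fun k _ => hw' k
  have hhs : h ∈ iterateSpan T c φ :=
    Submodule.subset_span (mem_iUnion.2 ⟨0, h, hh, rfl⟩)
  by_contra hcon
  obtain ⟨z, hz, hzf⟩ := not_subset.1 hcon
  have hzero := apply_pow_eq_zero_of_notMem_filledEssSpectrum (L := L) (E₀ := LinearMap.range ι)
    (ψ := ψ) (M := 2) (β := β) (Λ := lambdaInf T c φ l a) (x₀ := ι ⟨h, hhs⟩) (z₀ := z)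
    (by rintro _ ⟨f, rfl⟩; exact ⟨_, (hL f).symm⟩) hψ2
    (by
      rintro k _ ⟨f, rfl⟩
      rw [hL]
      refine (hψ (k + 1) (transferOnSpan T c φ f)).unique (hx0 _) (hx1 _) ?_
      rw [← hxT]
      exact hβ k f f.2 _ (hψ k f))
    (fun k => norm_ne_zero_iff.1 (by rw [hβn]; exact norm_ne_zero_iff.2 (hw' _))) hΛ
    (fun r hr hrΛ => by
      simp only [hβn]
      exact tendsto_pow_div_prod_norm rfl K hr hrΛ)
    (LinearMap.mem_range_self _ _)
    (by
      intro k
      obtain ⟨j, hj⟩ := hxb (k + 1)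
      exact (hψ (k + 1) ⟨h, hhs⟩).unique (hx0 _) (hx1 _)
        ((isPiecewiseContinuous_of_mem_piecewiseSmooth hh).continuousAt hj).hasJump)
    (by simpa using hz) hzf (K + 1)
  have h1 := hψ 0 ((transferOnSpan T c φ ^ (K + 1)) ⟨h, hhs⟩)
  rw [← (hiter _ _).1, (hiter _ _).2, hzero] at h1
  exact hd (hjump.unique (hx0 0) (hx1 0) h1)

theorem theorem1
    {T : unitInterval → unitInterval} {N : ℕ} {c : Fin (N + 1) → unitInterval}
    (hT : IsMaximalMonotonePartition T c)
    {φ : unitInterval → ℂ} (hφ_bdd : ∃ C : ℝ, ∀ x, ‖φ x‖ ≤ C)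
    (hφ : IsPiecewiseContinuous c φ)
    {B : Type*} [NormedAddCommGroup B] [NormedSpace ℂ B] [CompleteSpace B]
    -- `ι` is the inclusion into `B` of the span of the iterates of piecewise smooth functions,
    -- `L` is the continuous extension of the transfer operator to `B`
    (ι : iterateSpan T c φ →ₗ[ℂ] B) (L : B →L[ℂ] B)
    (hL : ∀ h, L (ι h) = ι (transferOnSpan T c φ h))
    (hι : ∀ h : iterateSpan T c φ, eLpNorm (h : unitInterval → ℂ) ∞ volume ≤ ‖ι h‖ₑ)
    {l : Fin N} {a : unitInterval} (ha : IsNontrivialDiscontinuity T c l a)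
    (hφa : boundaryWeight T c φ l a 0 ≠ 0) :
    ENNReal.ofReal (lambdaInf T c φ l a) ≤ essSpectralRadius L ∧
      (0 < lambdaInf T c φ l a →
        Metric.closedBall (0 : ℂ) (lambdaInf T c φ l a) ⊆ filledEssSpectrum L) := by
  have hball := closedBall_lambdaInf_subset_filledEssSpectrum hT.toIsMonotonePartition hφ ι L hL hι
    ha hφa
  refine ⟨?_, hball⟩
  rcases le_or_gt (lambdaInf T c φ l a) 0 with hΛ | hΛ
  · simp [ENNReal.ofReal_of_nonpos hΛ]
  · have hmem : (lambdaInf T c φ l a : ℂ) ∈ Metric.closedBall (0 : ℂ) (lambdaInf T c φ l a) := by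
      rw [mem_closedBall_zero_iff, Complex.norm_real, Real.norm_of_nonneg hΛ.le]
    refine le_trans (le_of_eq ?_) (enorm_le_essSpectralRadius (hball hΛ hmem))
    rw [← ofReal_norm, Complex.norm_real, Real.norm_of_nonneg hΛ.le]
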